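/- For an integer $n\ge 1$ let $\Lambda_n=\{-\lfloor n/2\rfloor,\dots,\lfloor n/2\rfloor\}^2\subset\mathbb Z^2$, write $x\sim y$ for nearest neighbours in $\mathbb Z^2$, and let $$\widetilde\Omega=\{\varphi:\Lambda_n\to\mathbb Z \;:\; \text{there are no } x\sim y \text{ in } \Lambda_n \text{ with } \varphi_x\le -1 \text{ and } \varphi_y\le 0\}.$$ For $\varphi\in\widetilde\Omega$ let $\mathsf Q_{\ge 2}(\varphi)=\{x\in\Lambda_n:\ \varphi_x\le 0 \text{ and } \varphi_y\le 0 \text{ for some } y\in\Lambda_n,\ y\sim x\}$. For $\beta>0$ put $\lambda_w=-\log(1-e^{-4\beta})$ and $h_n^*=\lfloor \frac1{6\beta}\log n+\frac13\rfloor$, and let $\widetilde{\mathbb P}$ be the probability measure on $\widetilde\Omega$ with $$\widetilde{\mathbb P}(\varphi)\ \propto\ \exp\Big(-\beta\sum_{x\sim y}|\varphi_x-\varphi_y|+\lambda_w\,|\mathsf Q_{\ge 2}(\varphi)|\Big),$$ where the sum runs over unordered pairs of neighbours in $\Lambda_n$ together with its outer vertex boundary $\partial\Lambda_n$, and $\varphi$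 is set to $0$ on $\partial\Lambda_n$. **Proposition.** There exist an absolute constant $C>0$ and $\beta_0$ such that for every $\beta>0$ with $\beta\ge\beta_0$ there is an $n_0=n_0(\beta)$ such that for all $n\ge n_0$, $$\widetilde{\mathbb P}\Big(\#\{x\in\Lambda_n:\ \varphi_x\ge h_n^*+1\}\ \ge\ C e^{-\beta}n^2\Big)\ \le\ e^{-n^{3/4}}.$$ -/

import Mathlib

open scoped ENNReal

noncomputable section

namespace SOS

/-- Nearest-neighbour adjacency `x ∼ y` in `ℤ²`. -/
def Adj (x y : ℤ × ℤ) : Prop := |x.1 - y.1| + |x.2 - y.2| = 1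

instance (x y : ℤ × ℤ) : Decidable (Adj x y) :=
  inferInstanceAs (Decidable (|x.1 - y.1| + |x.2 - y.2| = 1))

/-- The box `Λ_n = {-⌊n/2⌋, …, ⌊n/2⌋}²` (here `n / 2` is division in `ℕ`). -/
def box (n : ℕ) : Finset (ℤ × ℤ) :=
  Finset.Icc (-((n / 2 : ℕ) : ℤ)) ((n / 2 : ℕ) : ℤ) ×ˢ
    Finset.Icc (-((n / 2 : ℕ) : ℤ)) ((n / 2 : ℕ) : ℤ)

/-- The outer vertex boundary `∂Λ_n`: sites outside `Λ_n` with a neighbour in `Λ_n`. They are looked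
up in the box of side larger by two, which contains all of them. -/
def outerBoundary (n : ℕ) : Finset (ℤ × ℤ) :=
  (box (n + 2)).filter fun x => x ∉ box n ∧ ∃ y ∈ box n, Adj x y

/-- Integer-valued height functions on `Λ_n`. -/
abbrev Config (n : ℕ) : Type := box n → ℤ

/-- The extension of a height function by the boundary condition `0` outside `Λ_n`. -/
def extend {n : ℕ} (φ : Config n) (x : ℤ × ℤ) : ℤ :=
  if h : x ∈ box n then φ ⟨x, h⟩ else 0

/-- The total gradient `∑_{x ∼ y} |φ_x - φ_y|` over unordered nearest-neighbour pairs in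
`Λ_n ∪ ∂Λ_n`, with `φ = 0` on `∂Λ_n`. The double sum runs over ordered pairs, whence the `1 / 2`. -/
def gradient {n : ℕ} (φ : Config n) : ℝ :=
  (1 / 2) * ∑ x ∈ box n ∪ outerBoundary n, ∑ y ∈ box n ∪ outerBoundary n,
    if Adj x y then |((extend φ x : ℤ) : ℝ) - (extend φ y : ℝ)| else 0

/-- The relaxed state space: no two adjacent sites of `Λ_n` have heights `≤ -1` and `≤ 0`. -/
def relaxedSpace (n : ℕ) : Set (Config n) :=
  {φ | ¬ ∃ x y : box n, Adj x y ∧ φ x ≤ -1 ∧ φ y ≤ 0}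

/-- The set `Q_{≥ 2}(φ)` of sites at height `≤ 0` with a neighbour in `Λ_n` at height `≤ 0`. -/
def Q2 {n : ℕ} (φ : Config n) : Finset (box n) :=
  Finset.univ.filter fun x => φ x ≤ 0 ∧ ∃ y : box n, Adj x y ∧ φ y ≤ 0

open Classical in
/-- The unnormalized weight `exp(-β ∑_{x ∼ y} |φ_x - φ_y| + lam |Q_{≥ 2}(φ)|)` on the relaxed state
space, and `0` off that space. -/
def relaxedWeight (n : ℕ) (β lam : ℝ) (φ : Config n) : ℝ≥0∞ :=
  if φ ∈ relaxedSpace n then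
    ENNReal.ofReal (Real.exp (-β * gradient φ + lam * ((Q2 φ).card : ℝ)))
  else 0

lemma tsum_relaxedWeight_ne_zero (n : ℕ) (β lam : ℝ) :
    (∑' φ, relaxedWeight n β lam φ) ≠ 0 := by
  intro h
  have h0 := ENNReal.tsum_eq_zero.1 h (fun _ => 0)
  have hm : (fun _ => 0 : Config n) ∈ relaxedSpace n := by
    rintro ⟨x, y, -, hx, -⟩
    norm_num at hx
  rw [relaxedWeight, if_pos hm, ENNReal.ofReal_eq_zero] at h0
  exact absurd h0 (not_le.2 (Real.exp_pos _))

lemma gradient_nonneg {n : ℕ} (φ : Config n) : 0 ≤ gradient φ := by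
  unfold gradient
  refine mul_nonneg (by norm_num) (Finset.sum_nonneg fun x _ => Finset.sum_nonneg fun y _ => ?_)
  split_ifs <;> positivity

lemma edge_le_gradient {n : ℕ} (φ : Config n) {x y : ℤ × ℤ}
    (hx : x ∈ box n ∪ outerBoundary n) (hy : y ∈ box n ∪ outerBoundary n) (h : Adj x y) :
    |((extend φ x : ℤ) : ℝ) - (extend φ y : ℝ)| ≤ 2 * gradient φ := by
  unfold gradient
  have hnn : ∀ a b : ℤ × ℤ,
      0 ≤ if Adj a b then |((extend φ a : ℤ) : ℝ) - (extend φ b : ℝ)| else 0 := by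
    intro a b; split_ifs <;> positivity
  have h1 := Finset.single_le_sum (f := fun b =>
    if Adj x b then |((extend φ x : ℤ) : ℝ) - (extend φ b : ℝ)| else 0)
    (fun b _ => hnn x b) hy
  have h2 := Finset.single_le_sum (f := fun a => ∑ b ∈ box n ∪ outerBoundary n,
    if Adj a b then |((extend φ a : ℤ) : ℝ) - (extend φ b : ℝ)| else 0)
    (fun a _ => Finset.sum_nonneg fun b _ => hnn a b) hx
  simp only [if_pos h] at h1
  linarith

lemma abs_extend_le {n : ℕ} (φ : Config n) (j : ℕ) :
    ∀ x : ℤ × ℤ, x.1 = ((n / 2 : ℕ) : ℤ) + 1 - j →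
      |((extend φ x : ℤ) : ℝ)| ≤ j * (2 * gradient φ) := by
  induction j with
  | zero =>
    intro x hx
    have : x ∉ box n := by
      simp only [box, Finset.mem_product, Finset.mem_Icc, not_and]
      intro h; push_cast at hx; omega
    simp [extend, this]
  | succ j ih =>
    intro x hx
    have hg := gradient_nonneg φ
    by_cases hxb : x ∈ box n
    · have hadj : Adj x (x.1 + 1, x.2) := by simp [Adj]
      have hadj' : Adj (x.1 + 1, x.2) x := by simp [Adj]
      have hy : (x.1 + 1, x.2) ∈ box n ∪ outerBoundary n := by
        by_cases hb : (x.1 + 1, x.2) ∈ box n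
        · exact Finset.mem_union_left _ hb
        · refine Finset.mem_union_right _ (Finset.mem_filter.2 ⟨?_, hb, x, hxb, hadj'⟩)
          simp only [box, Finset.mem_product, Finset.mem_Icc] at hxb ⊢
          omega
      have h1 := edge_le_gradient φ (Finset.mem_union_left _ hxb) hy hadj
      have h2 := ih (x.1 + 1, x.2) (by push_cast at hx ⊢; omega)
      have h3 := abs_sub_abs_le_abs_sub ((extend φ x : ℤ) : ℝ) (extend φ (x.1 + 1, x.2) : ℝ)
      push_cast
      nlinarith
    · have : extend φ x = 0 := by simp [extend, hxb]
      rw [this]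
      simp only [Int.cast_zero, abs_zero]
      positivity

lemma summable_exp_neg_mul_abs {c : ℝ} (hc : 0 < c) :
    Summable fun k : ℤ => Real.exp (-c * |(k : ℝ)|) := by
  have h : Summable fun k : ℕ => Real.exp (-c * (k : ℝ)) := by
    have := Real.summable_exp_nat_mul_iff.2 (neg_lt_zero.2 hc)
    simpa [mul_comm] using this
  apply Summable.of_nat_of_neg <;> simpa using h

lemma summable_prod_exp (ι : Type) [Fintype ι] {c : ℝ} (hc : 0 < c) :
    Summable fun φ : ι → ℤ => ∏ x, Real.exp (-c * |(φ x : ℝ)|) := by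
  classical
  have hnn : ∀ k : ℤ, 0 ≤ Real.exp (-c * |(k : ℝ)|) := fun k => (Real.exp_pos _).le
  refine summable_of_sum_le (c := ∏ _x : ι, ∑' k : ℤ, Real.exp (-c * |(k : ℝ)|)) ?_ ?_
  · intro φ
    exact Finset.prod_nonneg fun x _ => hnn _
  intro s
  have hs : s ⊆ Fintype.piFinset fun x => s.image fun φ => φ x := by
    intro φ hφ
    exact Fintype.mem_piFinset.2 fun x => Finset.mem_image_of_mem _ hφ
  refine (Finset.sum_le_sum_of_subset_of_nonneg hs
    fun φ _ _ => Finset.prod_nonneg fun x _ => hnn _).trans ?_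
  rw [← Finset.prod_univ_sum (fun x => s.image fun φ => φ x)
    fun _ (k : ℤ) => Real.exp (-c * |(k : ℝ)|)]
  refine Finset.prod_le_prod (fun x _ => Finset.sum_nonneg fun k _ => hnn k) fun x _ => ?_
  exact (summable_exp_neg_mul_abs hc).sum_le_tsum _ fun k _ => hnn k

/-- The partition function is finite, so the normalization below is legitimate. -/
lemma tsum_relaxedWeight_ne_top (n : ℕ) {β : ℝ} (hβ : 0 < β) (lam : ℝ) :
    (∑' φ, relaxedWeight n β lam φ) ≠ ∞ := by
  set N : ℝ := (Fintype.card (box n) + 1) * ((2 * (n / 2 : ℕ) + 1) * 2) with hN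
  have hNpos : 0 < N := by positivity
  set K : ℝ := Real.exp (|lam| * Fintype.card (box n)) with hK
  have hsum := (summable_prod_exp (box n) (div_pos hβ hNpos)).mul_left K
  refine ne_top_of_le_ne_top hsum.tsum_ofReal_ne_top (ENNReal.tsum_le_tsum fun φ => ?_)
  unfold relaxedWeight
  split_ifs
  swap
  · exact zero_le
  apply ENNReal.ofReal_le_ofReal
  rw [hK, ← Real.exp_sum, ← Real.exp_add, Real.exp_le_exp, ← Finset.mul_sum]
  have hg := gradient_nonneg φ
  have hx : ∀ x : box n, |(φ x : ℝ)| ≤ (2 * (n / 2 : ℕ) + 1) * 2 * gradient φ := by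
    intro x
    have hxb := x.2
    simp only [box, Finset.mem_product, Finset.mem_Icc] at hxb
    have h := abs_extend_le φ (((n / 2 : ℕ) : ℤ) + 1 - x.1.1).toNat x.1 (by omega)
    have he : extend φ x.1 = φ x := by simp [extend]
    rw [he] at h
    have hj : (((((n / 2 : ℕ) : ℤ) + 1 - x.1.1).toNat : ℕ) : ℝ) ≤ 2 * (n / 2 : ℕ) + 1 := by
      have : (((n / 2 : ℕ) : ℤ) + 1 - x.1.1).toNat ≤ 2 * (n / 2 : ℕ) + 1 := by omega
      exact_mod_cast this
    refine h.trans ?_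
    rw [mul_assoc]
    exact mul_le_mul_of_nonneg_right hj (by positivity)
  have hS : ∑ x, |(φ x : ℝ)| ≤ N * gradient φ := by
    calc ∑ x, |(φ x : ℝ)| ≤ ∑ _x : box n, (2 * (n / 2 : ℕ) + 1) * 2 * gradient φ :=
          Finset.sum_le_sum fun x _ => hx x
      _ = Fintype.card (box n) * ((2 * (n / 2 : ℕ) + 1) * 2 * gradient φ) := by
          rw [Finset.sum_const, nsmul_eq_mul, Finset.card_univ]
      _ ≤ N * gradient φ := by
          rw [hN]
          have : 0 ≤ (2 * ((n / 2 : ℕ) : ℝ) + 1) * 2 * gradient φ := by positivity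
          nlinarith
  have h1 : β / N * ∑ x, |(φ x : ℝ)| ≤ β * gradient φ := by
    calc _ ≤ β / N * (N * gradient φ) := mul_le_mul_of_nonneg_left hS (by positivity)
      _ = _ := by field_simp
  have hq : ((Q2 φ).card : ℝ) ≤ Fintype.card (box n) := by exact_mod_cast Finset.card_le_univ _
  have h2 : lam * ((Q2 φ).card : ℝ) ≤ |lam| * Fintype.card (box n) :=
    (mul_le_mul_of_nonneg_right (le_abs_self lam) (Nat.cast_nonneg _)).trans
      (mul_le_mul_of_nonneg_left hq (abs_nonneg _))
  linarith

/-- The relaxed SOS measure on the relaxed state space with `0` boundary condition: the probability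
measure proportional to `relaxedWeight`. -/
def relaxedSOS (n : ℕ) (β : ℝ) (hβ : 0 < β) (lam : ℝ) : PMF (Config n) :=
  PMF.normalize (relaxedWeight n β lam) (tsum_relaxedWeight_ne_zero n β lam)
    (tsum_relaxedWeight_ne_top n hβ lam)

/-- The critical pinning strength `λ_w = -log(1 - e^{-4β})`. -/
def lamW (β : ℝ) : ℝ := -Real.log (1 - Real.exp (-4 * β))

/-- The height `h_n^* = ⌊(1 / (6β)) log n + 1/3⌋`. -/
def hStar (n : ℕ) (β : ℝ) : ℤ := ⌊1 / (6 * β) * Real.log n + 1 / 3⌋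

end SOS

end

open scoped ENNReal

namespace SOS

/-! Pass from a configuration to its positive part. In the relaxed space a negative site has only
neighbours of positive height inside the box, so it sits over an isolated zero of the positive part,
and pushing that zero down by `k` costs exactly `4k` in the gradient. Summing `exp(-4βk)` over `k ≥
0` gives `exp(lamW β)`. The positive part therefore has the SOS weight on non-negative heights with
reward `lamW β` for every zero, isolated or not (`tsum_fibre_posPart`), and the event depends on the
positive part only.

For this pinned model, `exp(lamW β) = 1 + exp(lamW β - 4β)` makes shifting the surface inside a
contour exact. When heights are lowered by one, each new zero was either at height 1 or already at
height 0; the second option costs four edges and keeps the reward, and the two options together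
reproduce the weight of a zero. Raising inside a downward contour `D` thus gains `exp(β per D)`
without restriction (`mass_down_le`). Lowering inside an upward contour `F` gains `exp(β per F)` if
no neighbours in `F` have heights `0` and `≤ 1` (`mass_up_le`).

Such a bad pair is rare inside a contour at level `h`. A Peierls argument with downward contours,
repeated once per level, gives conditional probability at most a constant times `exp(-4β-6βh)`
(`rmass_bad_le`): four edges around the first site, then six around the pair for each of `h` levels.
The choice of `hStar` makes this `O(1/n)`. Since raising preserves increasing events, the absence of
bad pairs can be imposed one pair at a time, with a total factor of at least `exp(-O(|F|/n))`. As
`|F|` is at most of order `n per F`, this loss is absorbed: an upward contour around `F` has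
probability at most `exp(-(β - 2^38) per F)` (`rmass_isUp_le`).

The bound holds for unions of outermost contours, so these are dominated by independent ones. An
exponential Markov inequality for their total area divided by `n` (`rmass_mul_exp_le`) gives
`rmass_many_high_le`, with exponent of order `exp(-β) n`, which exceeds `n^(3/4)` for large `n`. -/

/-! ### Perimeter and isoperimetry of finite lattice sets. -/

/-- The four unit steps of `ℤ²`. -/
def dirs : Finset (ℤ × ℤ) := {(1, 0), (-1, 0), (0, 1), (0, -1)}

lemma card_dirs : dirs.card = 4 := by decide

lemma adj_iff {x y : ℤ × ℤ} : Adj x y ↔ ∃ d ∈ dirs, y = x + d := by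
  obtain ⟨a, b⟩ := x
  obtain ⟨c, e⟩ := y
  simp only [Adj, dirs, Finset.mem_insert, Finset.mem_singleton, exists_eq_or_imp,
    exists_eq_left, Prod.mk_add_mk, Prod.mk.injEq]
  constructor
  · intro h
    rcases abs_cases (a - c) with h1 | h1 <;> rcases abs_cases (b - e) with h2 | h2 <;> omega
  · rintro (⟨rfl, rfl⟩ | ⟨rfl, rfl⟩ | ⟨rfl, rfl⟩ | ⟨rfl, rfl⟩) <;> simp

lemma Adj.symm {x y : ℤ × ℤ} (h : Adj x y) : Adj y x := by
  unfold Adj at *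
  rwa [abs_sub_comm, abs_sub_comm y.2]

lemma adj_comm {x y : ℤ × ℤ} : Adj x y ↔ Adj y x := ⟨Adj.symm, Adj.symm⟩

/-- Pairs `(x, d)` such that the step `d` leads from `x ∈ D` out of `D`. -/
def outPairs (D : Finset (ℤ × ℤ)) : Finset ((ℤ × ℤ) × (ℤ × ℤ)) :=
  (D ×ˢ dirs).filter fun q => q.1 + q.2 ∉ D

/-- The number of edges between `D` and its complement. -/
def per (D : Finset (ℤ × ℤ)) : ℕ := (outPairs D).card

/-- `f` labels the lines in direction `d` and `g` is the coordinate along them. On each line that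
meets `D`, the last site of `D` is an exit. -/
lemma card_image_le_exits (D : Finset (ℤ × ℤ)) (d : ℤ × ℤ) (f g : ℤ × ℤ → ℤ)
    (hf : ∀ x, f (x + d) = f x) (hg : ∀ x, g (x + d) = g x + 1) :
    (D.image f).card ≤ (D.filter fun x => x + d ∉ D).card := by
  refine le_trans (Finset.card_le_card ?_) (Finset.card_image_le (f := f))
  intro b hb
  obtain ⟨x, hx, rfl⟩ := Finset.mem_image.1 hb
  obtain ⟨m, hm, hmax⟩ := Finset.exists_max_image (D.filter fun y => f y = f x) g
    ⟨x, Finset.mem_filter.2 ⟨hx, rfl⟩⟩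
  rw [Finset.mem_filter] at hm
  refine Finset.mem_image.2 ⟨m, Finset.mem_filter.2 ⟨hm.1, fun h => ?_⟩, hm.2⟩
  have := hmax (m + d) (Finset.mem_filter.2 ⟨h, (hf m).trans hm.2⟩)
  rw [hg] at this
  omega

lemma per_eq_sum (D : Finset (ℤ × ℤ)) :
    per D = ∑ d ∈ dirs, (D.filter fun x => x + d ∉ D).card := by
  simp only [per, outPairs, Finset.card_filter, Finset.sum_product]
  exact Finset.sum_comm

lemma two_mul_projections_le_per (D : Finset (ℤ × ℤ)) :
    2 * (D.image Prod.fst).card + 2 * (D.image Prod.snd).card ≤ per D := by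
  have h1 := card_image_le_exits D (1, 0) Prod.snd Prod.fst (by simp) (by simp)
  have h2 := card_image_le_exits D (-1, 0) Prod.snd (fun x => -x.1) (by simp)
    (by intro x; simp; ring)
  have h3 := card_image_le_exits D (0, 1) Prod.fst Prod.snd (by simp) (by simp)
  have h4 := card_image_le_exits D (0, -1) Prod.fst (fun x => -x.2) (by simp)
    (by intro x; simp; ring)
  have : per D = (D.filter fun x => x + (1, 0) ∉ D).card +
      ((D.filter fun x => x + (-1, 0) ∉ D).card +
      ((D.filter fun x => x + (0, 1) ∉ D).card + (D.filter fun x => x + (0, -1) ∉ D).card)) := by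
    rw [per_eq_sum, dirs, Finset.sum_insert (by decide), Finset.sum_insert (by decide),
      Finset.sum_insert (by decide), Finset.sum_singleton]
  omega

lemma card_le_projections (D : Finset (ℤ × ℤ)) :
    D.card ≤ (D.image Prod.fst).card * (D.image Prod.snd).card := by
  rw [← Finset.card_product]
  refine Finset.card_le_card fun x hx => Finset.mem_product.2
    ⟨Finset.mem_image_of_mem _ hx, Finset.mem_image_of_mem _ hx⟩

/-- The values 4, 6, 8 for at least 1, 2, 3 sites come from `|D| ≤ rc` and `2(r + c) ≤ per D`, with
`r`, `c` the sizes of the projections. They produce the exponents of the bad-pair estimate. -/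
lemma four_le_per {D : Finset (ℤ × ℤ)} (h : 1 ≤ D.card) : 4 ≤ per D := by
  have h1 := two_mul_projections_le_per D
  have h2 := card_le_projections D
  generalize (D.image Prod.fst).card = r at *
  generalize (D.image Prod.snd).card = c at *
  rcases Nat.eq_zero_or_pos r with rfl | hr
  · omega
  rcases Nat.eq_zero_or_pos c with rfl | hc
  · omega
  omega

lemma six_le_per {D : Finset (ℤ × ℤ)} (h : 2 ≤ D.card) : 6 ≤ per D := by
  have h1 := two_mul_projections_le_per D
  have h2 := card_le_projections D
  generalize (D.image Prod.fst).card = r at *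
  generalize (D.image Prod.snd).card = c at *
  by_contra hlt
  have hr : r ≤ 2 := by omega
  have hc : c ≤ 2 := by omega
  interval_cases r <;> interval_cases c <;> omega

lemma eight_le_per {D : Finset (ℤ × ℤ)} (h : 3 ≤ D.card) : 8 ≤ per D := by
  have h1 := two_mul_projections_le_per D
  have h2 := card_le_projections D
  generalize (D.image Prod.fst).card = r at *
  generalize (D.image Prod.snd).card = c at *
  by_contra hlt
  have hr : r ≤ 3 := by omega
  have hc : c ≤ 3 := by omega
  interval_cases r <;> interval_cases c <;> omega

lemma card_le_per_sq (D : Finset (ℤ × ℤ)) : D.card ≤ per D ^ 2 := by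
  have h1 := two_mul_projections_le_per D
  have h2 := card_le_projections D
  rw [sq]
  exact h2.trans (Nat.mul_le_mul (by omega) (by omega))

/-- Linear rather than quadratic in the perimeter: a cost of order `1/n` per site becomes a bounded
cost per boundary edge. -/
lemma two_mul_card_le_of_subset_box {n : ℕ} {D : Finset (ℤ × ℤ)} (h : D ⊆ box n) :
    2 * D.card ≤ (n + 1) * per D := by
  have h1 := two_mul_projections_le_per D
  have h2 := card_le_projections D
  have h3 : (D.image Prod.fst).card ≤ n + 1 := by
    have : D.image Prod.fst ⊆ Finset.Icc (-((n / 2 : ℕ) : ℤ)) ((n / 2 : ℕ) : ℤ) := by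
      intro a ha
      obtain ⟨x, hx, rfl⟩ := Finset.mem_image.1 ha
      exact (Finset.mem_product.1 (h hx)).1
    refine (Finset.card_le_card this).trans ?_
    rw [Int.card_Icc]
    omega
  calc 2 * D.card ≤ 2 * ((D.image Prod.fst).card * (D.image Prod.snd).card) := by omega
    _ = (D.image Prod.fst).card * (2 * (D.image Prod.snd).card) := by ring
    _ ≤ (n + 1) * per D := Nat.mul_le_mul h3 (by omega)

/-! ### Boundary edges and the lattice-animal bound. -/

/-- The unit vector of an (undirected) edge: horizontal for `false`, vertical for `true`. -/
def unitVec : Bool → ℤ × ℤ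
  | false => (1, 0)
  | true => (0, 1)

/-- The undirected edge traversed by the step `d` from `x`; the pair `(p, b)` stands for the edge
from `p` to `p + unitVec b`. -/
def edgeOf (q : (ℤ × ℤ) × (ℤ × ℤ)) : (ℤ × ℤ) × Bool :=
  if q.2 = (1, 0) then (q.1, false)
  else if q.2 = (-1, 0) then (q.1 - (1, 0), false)
  else if q.2 = (0, 1) then (q.1, true)
  else (q.1 - (0, 1), true)

/-- The boundary edges of `D`. -/
def bdry (D : Finset (ℤ × ℤ)) : Finset ((ℤ × ℤ) × Bool) := (outPairs D).image edgeOf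

lemma card_bdry_le (D : Finset (ℤ × ℤ)) : (bdry D).card ≤ per D := Finset.card_image_le

lemma mem_bdry {D : Finset (ℤ × ℤ)} {e : (ℤ × ℤ) × Bool} :
    e ∈ bdry D ↔ ¬ (e.1 ∈ D ↔ e.1 + unitVec e.2 ∈ D) := by
  obtain ⟨p, b⟩ := e
  constructor
  · intro h
    obtain ⟨⟨x, d⟩, hq, he⟩ := Finset.mem_image.1 h
    obtain ⟨hq1, hq2⟩ := Finset.mem_filter.1 hq
    obtain ⟨hx, hd⟩ := Finset.mem_product.1 hq1
    simp only [dirs, Finset.mem_insert, Finset.mem_singleton] at hd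
    simp only at hx hd hq2
    rcases hd with rfl | rfl | rfl | rfl <;> simp [edgeOf] at he <;> obtain ⟨rfl, rfl⟩ := he <;>
      simp [unitVec, hx]
    · exact hq2
    · rw [sub_eq_add_neg]; simpa using hq2
    · exact hq2
    · rw [sub_eq_add_neg]; simpa using hq2
  · intro h
    simp only at h
    by_cases hp : p ∈ D
    · have h2 : p + unitVec b ∉ D := fun h' => h (by simp [hp, h'])
      refine Finset.mem_image.2 ⟨(p, unitVec b), Finset.mem_filter.2
        ⟨Finset.mem_product.2 ⟨hp, ?_⟩, h2⟩, ?_⟩ <;> cases b <;> simp [unitVec, dirs, edgeOf]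
    · have h2 : p + unitVec b ∈ D := by
        by_contra h'; exact h (by simp [hp, h'])
      refine Finset.mem_image.2 ⟨(p + unitVec b, - unitVec b), Finset.mem_filter.2
        ⟨Finset.mem_product.2 ⟨h2, ?_⟩, by simpa using hp⟩, ?_⟩ <;>
      cases b <;> simp [unitVec, dirs, edgeOf]

/-- The six edges that share a plaquette with the given edge. -/
def plaqNbrs (e : (ℤ × ℤ) × Bool) : Finset ((ℤ × ℤ) × Bool) :=
  {(e.1 + unitVec (!e.2), e.2), (e.1, !e.2), (e.1 + unitVec e.2, !e.2),
    (e.1 - unitVec (!e.2), e.2), (e.1 - unitVec (!e.2), !e.2),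
    (e.1 - unitVec (!e.2) + unitVec e.2, !e.2)}

lemma card_plaqNbrs_le (e : (ℤ × ℤ) × Bool) : (plaqNbrs e).card ≤ 6 := Finset.card_le_six

/-- Lattice-animal bound, obtained from site percolation with parameter `1 / 2`. -/
lemma sum_connected_le {α : Type*} [DecidableEq α] (N : α → Finset α) (d : ℕ)
    (hN : ∀ a, (N a).card ≤ d) (a₀ : α) (𝓔 : Finset (Finset α))
    (h𝓔 : ∀ E ∈ 𝓔, a₀ ∈ E ∧ ∀ E₁ ⊆ E, a₀ ∈ E₁ → (∀ a ∈ E₁, ∀ b ∈ E, b ∈ N a → b ∈ E₁) → E₁ = E) :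
    ∑ E ∈ 𝓔, ((1 / 2 : ℝ) ^ (d + 1)) ^ E.card ≤ 1 := by
  classical
  set U := 𝓔.biUnion fun E => E ∪ E.biUnion N with hU
  -- The percolation configurations in which the open cluster of `a₀` is `E`. They are disjoint for
  -- different `E`, and each fixes at most `(d + 1)|E|` sites, so it has probability at least
  -- `2^(-(d+1)|E|)`.
  set Ω : Finset α → Finset (Finset α) := fun E =>
    U.powerset.filter fun ω => E ⊆ ω ∧ ∀ a ∈ E, ∀ b ∈ N a, b ∈ ω → b ∈ E with hΩ
  have hdisj : ∀ E ∈ 𝓔, ∀ E' ∈ 𝓔, E ≠ E' → Disjoint (Ω E) (Ω E') := by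
    intro E hE E' hE' hne
    rw [Finset.disjoint_left]
    intro ω hω hω'
    obtain ⟨-, h1, h2⟩ := Finset.mem_filter.1 hω
    obtain ⟨-, h1', h2'⟩ := Finset.mem_filter.1 hω'
    obtain ⟨ha, hc⟩ := h𝓔 E hE
    obtain ⟨ha', hc'⟩ := h𝓔 E' hE'
    apply hne
    have e1 := hc (E ∩ E') Finset.inter_subset_left (Finset.mem_inter.2 ⟨ha, ha'⟩)
      fun a haE b hb hab => Finset.mem_inter.2
        ⟨hb, h2' a (Finset.mem_inter.1 haE).2 b hab (h1 hb)⟩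
    have e2 := hc' (E ∩ E') Finset.inter_subset_right (Finset.mem_inter.2 ⟨ha, ha'⟩)
      fun a haE b hb hab => Finset.mem_inter.2
        ⟨h2 a (Finset.mem_inter.1 haE).1 b hab (h1' hb), hb⟩
    exact e1.symm.trans e2
  have hcard : ∀ E ∈ 𝓔, 2 ^ U.card * ((1 / 2 : ℝ) ^ (d + 1)) ^ E.card ≤ ((Ω E).card : ℝ) := by
    intro E hE
    set M := E ∪ E.biUnion N with hM
    have hMU : M ⊆ U := Finset.subset_biUnion_of_mem (fun E => E ∪ E.biUnion N) hE
    have hMc : M.card ≤ (d + 1) * E.card := by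
      refine (Finset.card_union_le _ _).trans ?_
      have := Finset.card_biUnion_le_card_mul E N d fun a _ => hN a
      nlinarith
    have h1 : (U \ M).powerset.card ≤ (Ω E).card := by
      refine Finset.card_le_card_of_injOn (fun ω => ω ∪ E) ?_ ?_
      · intro ω hω
        have hω := Finset.mem_powerset.1 (Finset.mem_coe.1 hω)
        refine Finset.mem_coe.2 (Finset.mem_filter.2 ⟨Finset.mem_powerset.2 ?_,
          Finset.subset_union_right, ?_⟩)
        · exact Finset.union_subset (hω.trans Finset.sdiff_subset)
            (Finset.subset_union_left.trans hMU)
        · intro a ha b hb hbω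
          rcases Finset.mem_union.1 hbω with h | h
          · exact absurd (Finset.mem_union_right _ (Finset.mem_biUnion.2 ⟨a, ha, hb⟩))
              (Finset.mem_sdiff.1 (hω h)).2
          · exact h
      · intro ω hω ω' hω' heq
        have hω := Finset.mem_powerset.1 (Finset.mem_coe.1 hω)
        have hω' := Finset.mem_powerset.1 (Finset.mem_coe.1 hω')
        have key : ∀ σ : Finset α, σ ⊆ U \ M → (σ ∪ E) \ E = σ := by
          intro σ hσ
          rw [Finset.union_sdiff_right]
          refine Finset.sdiff_eq_self_of_disjoint (Finset.disjoint_left.2 fun a ha haE => ?_)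
          exact (Finset.mem_sdiff.1 (hσ ha)).2 (Finset.mem_union_left _ haE)
        simp only at heq
        rw [← key ω hω, ← key ω' hω', heq]
    rw [Finset.card_powerset, Finset.card_sdiff_of_subset hMU] at h1
    have hMU' := Finset.card_le_card hMU
    have h2 : (2 : ℝ) ^ (U.card - M.card) ≤ ((Ω E).card : ℝ) := by exact_mod_cast h1
    refine le_trans ?_ h2
    have h3 : (2 : ℝ) ^ U.card = 2 ^ (U.card - M.card) * 2 ^ M.card := by
      rw [← pow_add]; congr 1; omega
    rw [← pow_mul, h3, mul_assoc]
    refine mul_le_of_le_one_right (by positivity) ?_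
    rw [one_div, inv_pow]
    rw [← div_eq_mul_inv]
    exact div_le_one_of_le₀ (pow_le_pow_right₀ (by norm_num) hMc) (by positivity)
  have hsum : ∑ E ∈ 𝓔, ((Ω E).card : ℝ) ≤ 2 ^ U.card := by
    have : (𝓔.biUnion Ω).card ≤ U.powerset.card := Finset.card_le_card
      (Finset.biUnion_subset.2 fun E _ => Finset.filter_subset _ _)
    rw [Finset.card_biUnion hdisj, Finset.card_powerset] at this
    exact_mod_cast this
  have h4 : 2 ^ U.card * ∑ E ∈ 𝓔, ((1 / 2 : ℝ) ^ (d + 1)) ^ E.card ≤ 2 ^ U.card := by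
    rw [Finset.mul_sum]
    exact (Finset.sum_le_sum hcard).trans hsum
  have h5 : (0 : ℝ) < 2 ^ U.card := by positivity
  nlinarith

/-! ### Connectedness of the boundary of a blob, by mod 2 cohomology. -/

/-- A function on `ℤ` with prescribed differences. -/
lemma exists_antidifference {A : Type*} [AddCommGroup A] (g : ℤ → A) :
    ∃ G : ℤ → A, G 0 = 0 ∧ ∀ k, G (k + 1) = G k + g k := by
  refine ⟨fun k => ∑ i ∈ Finset.range k.toNat, g i -
    ∑ i ∈ Finset.range (-k).toNat, g (-1 - i), by simp, fun k => ?_⟩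
  rcases le_or_gt 0 k with hk | hk
  · lift k to ℕ using hk
    have h1 : ((k : ℤ) + 1).toNat = k + 1 := by omega
    have h2 : (-((k : ℤ) + 1)).toNat = 0 := by omega
    have h3 : (-(k : ℤ)).toNat = 0 := by omega
    simp only [h1, h2, h3]
    simp [Finset.sum_range_succ]
  · obtain ⟨m, rfl⟩ : ∃ m : ℕ, k = -(m : ℤ) - 1 := ⟨(-k - 1).toNat, by omega⟩
    have h1 : (-(m : ℤ) - 1 + 1).toNat = 0 := by omega
    have h2 : (-(-(m : ℤ) - 1 + 1)).toNat = m := by omega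
    have h3 : (-(m : ℤ) - 1).toNat = 0 := by omega
    have h4 : (-(-(m : ℤ) - 1)).toNat = m + 1 := by omega
    have h5 : -1 - (m : ℤ) = -(m : ℤ) - 1 := by ring
    simp only [h1, h2, h3, h4, Finset.sum_range_succ, h5, Finset.range_zero, Finset.sum_empty]
    abel

/-- A closed one-cochain on `ℤ²` is exact. -/
lemma exists_potential {A : Type*} [AddCommGroup A] (χ : (ℤ × ℤ) × Bool → A)
    (hχ : ∀ a b : ℤ, χ ((a, b), false) + χ ((a + 1, b), true) =
      χ ((a, b), true) + χ ((a, b + 1), false)) :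
    ∃ u : ℤ × ℤ → A, ∀ e, u (e.1 + unitVec e.2) = u e.1 + χ e := by
  obtain ⟨S, -, hS⟩ := exists_antidifference fun a => χ ((a, 0), false)
  choose T hT0 hT using fun a => exists_antidifference fun b => χ ((a, b), true)
  have key : ∀ a b, T (a + 1) b + χ ((a, 0), false) = T a b + χ ((a, b), false) := by
    intro a b
    induction b using Int.induction_on with
    | zero => simp [hT0]
    | succ i ih =>
      rw [hT, hT]
      have := hχ a i
      calc _ = (T (a + 1) i + χ ((a, 0), false)) + χ ((a + 1, (i : ℤ)), true) := by abel
        _ = T a i + (χ ((a, (i : ℤ)), false) + χ ((a + 1, (i : ℤ)), true)) := by rw [ih]; abel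
        _ = _ := by rw [this]; abel
    | pred i ih =>
      have h1 := hT (a + 1) (-(i : ℤ) - 1)
      have h2 := hT a (-(i : ℤ) - 1)
      have := hχ a (-(i : ℤ) - 1)
      rw [sub_add_cancel] at h1 h2 this
      rw [h1, h2] at ih
      have h3 : (T (a + 1) (-(i : ℤ) - 1) + χ ((a, 0), false)) + χ ((a + 1, -(i : ℤ) - 1), true) =
          (T a (-(i : ℤ) - 1) + χ ((a, -(i : ℤ) - 1), false)) + χ ((a + 1, -(i : ℤ) - 1), true) := by
        calc _ = T (a + 1) (-(i : ℤ) - 1) + χ ((a + 1, -(i : ℤ) - 1), true) +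
              χ ((a, 0), false) := by abel
          _ = T a (-(i : ℤ) - 1) + (χ ((a, -(i : ℤ) - 1), true) + χ ((a, -(i : ℤ)), false)) := by
              rw [ih]; abel
          _ = _ := by rw [← this]; abel
      exact add_right_cancel h3
  refine ⟨fun p => S p.1 + T p.1 p.2, ?_⟩
  rintro ⟨⟨a, b⟩, c⟩
  cases c
  · simp only [unitVec, Prod.mk_add_mk, add_zero]
    rw [hS, add_assoc, add_comm (χ _), key, add_assoc]
  · simp only [unitVec, Prod.mk_add_mk, add_zero]
    rw [hT, add_assoc]

/-- Connectedness by nearest-neighbour paths inside `A`. -/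
def Linked (A : Set (ℤ × ℤ)) : ℤ × ℤ → ℤ × ℤ → Prop :=
  Relation.ReflTransGen fun a b => Adj a b ∧ a ∈ A ∧ b ∈ A

lemma Linked.symm {A : Set (ℤ × ℤ)} {x y : ℤ × ℤ} (h : Linked A x y) : Linked A y x := by
  induction h with
  | refl => exact Relation.ReflTransGen.refl
  | tail _ hbc ih => exact Relation.ReflTransGen.head ⟨hbc.1.symm, hbc.2.2, hbc.2.1⟩ ih

lemma Linked.trans {A : Set (ℤ × ℤ)} {x y z : ℤ × ℤ} (h : Linked A x y) (h' : Linked A y z) :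
    Linked A x z := Relation.ReflTransGen.trans h h'

lemma Linked.mono {A B : Set (ℤ × ℤ)} (hAB : A ⊆ B) {x y : ℤ × ℤ} (h : Linked A x y) :
    Linked B x y := by
  induction h with
  | refl => exact Relation.ReflTransGen.refl
  | tail _ hbc ih => exact ih.tail ⟨hbc.1, hAB hbc.2.1, hAB hbc.2.2⟩

lemma Linked.mem {A : Set (ℤ × ℤ)} {x y : ℤ × ℤ} (h : Linked A x y) (hx : x ∈ A) : y ∈ A := by
  induction h with
  | refl => exact hx
  | tail _ hbc _ => exact hbc.2.2

lemma Linked.eq_of_step {A : Set (ℤ × ℤ)} {β : Type*} {u : ℤ × ℤ → β} {x y : ℤ × ℤ}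
    (h : Linked A x y) (hu : ∀ a b, Adj a b → a ∈ A → b ∈ A → u a = u b) : u x = u y := by
  induction h with
  | refl => rfl
  | tail _ hbc ih => exact ih.trans (hu _ _ hbc.1 hbc.2.1 hbc.2.2)

/-- Finite sets that are connected together with their complements. -/
structure Blob (D : Finset (ℤ × ℤ)) : Prop where
  conn : ∀ x ∈ D, ∀ y ∈ D, Linked (D : Set (ℤ × ℤ)) x y
  coconn : ∀ x ∉ D, ∀ y ∉ D, Linked (D : Set (ℤ × ℤ))ᶜ x y

lemma adj_iff_unitVec {x y : ℤ × ℤ} :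
    Adj x y ↔ ∃ b, y = x + unitVec b ∨ x = y + unitVec b := by
  obtain ⟨a, b⟩ := x
  obtain ⟨c, e⟩ := y
  simp only [adj_iff, dirs, Finset.mem_insert, Finset.mem_singleton, exists_eq_or_imp,
    exists_eq_left, Bool.exists_bool, unitVec, Prod.mk_add_mk, Prod.mk.injEq]
  omega

/-- The boundary of a blob is connected through plaquettes. -/
lemma Blob.bdry_connected {D : Finset (ℤ × ℤ)} (hD : Blob D) {e₀ : (ℤ × ℤ) × Bool}
    {E : Finset ((ℤ × ℤ) × Bool)} (hE : E ⊆ bdry D) (he₀ : e₀ ∈ E)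
    (hcl : ∀ a ∈ E, ∀ b ∈ bdry D, b ∈ plaqNbrs a → b ∈ E) : E = bdry D := by
  classical
  -- The boundary edges on one plaquette are even in number, and closure under `plaqNbrs` puts all
  -- or none of them in `E`. So `χ` is closed, hence the differential of some `u`. Away from `bdry
  -- D` it vanishes, so `u` is constant on `D` and on its complement, and jumps across all boundary
  -- edges or across none.
  set χ : (ℤ × ℤ) × Bool → ZMod 2 := fun e => if e ∈ E then 1 else 0 with hχ
  have hclosed : ∀ a b : ℤ, χ ((a, b), false) + χ ((a + 1, b), true) =
      χ ((a, b), true) + χ ((a, b + 1), false) := by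
    intro a b
    have m1 := @hE ((a, b), false)
    have m2 := @hE ((a + 1, b), true)
    have m3 := @hE ((a, b), true)
    have m4 := @hE ((a, b + 1), false)
    have iff_of : ∀ e e', e ∈ bdry D → e' ∈ bdry D → e' ∈ plaqNbrs e → e ∈ plaqNbrs e' →
        (e ∈ E ↔ e' ∈ E) := fun e e' h h' hn hn' =>
      ⟨fun he => hcl e he e' h' hn, fun he => hcl e' he e h hn'⟩
    have d12 := iff_of ((a, b), false) ((a + 1, b), true)
    have d13 := iff_of ((a, b), false) ((a, b), true)
    have d14 := iff_of ((a, b), false) ((a, b + 1), false)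
    have d23 := iff_of ((a + 1, b), true) ((a, b), true)
    have d24 := iff_of ((a + 1, b), true) ((a, b + 1), false)
    have d34 := iff_of ((a, b), true) ((a, b + 1), false)
    clear iff_of hcl
    simp only [mem_bdry, unitVec, Prod.mk_add_mk, add_zero] at m1 m2 m3 m4
    simp [mem_bdry, unitVec, plaqNbrs] at d12 d13 d14 d23 d24 d34
    have two : ∀ z : ZMod 2, z + z = 0 := by decide
    simp only [hχ]
    by_cases q1 : (a, b) ∈ D <;> by_cases q2 : (a + 1, b) ∈ D <;> by_cases q3 : (a, b + 1) ∈ D <;>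
      by_cases q4 : (a + 1, b + 1) ∈ D <;> simp_all
  obtain ⟨u, hu⟩ := exists_potential χ hclosed
  have hstep : ∀ x y : ℤ × ℤ, Adj x y → (x ∈ D ↔ y ∈ D) → u x = u y := by
    intro x y hxy h
    obtain ⟨b, rfl | rfl⟩ := adj_iff_unitVec.1 hxy
    · have : (x, b) ∉ E := fun hm => mem_bdry.1 (hE hm) h
      simp [hu (x, b), hχ, this]
    · have : (y, b) ∉ E := fun hm => mem_bdry.1 (hE hm) h.symm
      simp [hu (y, b), hχ, this]
  have hin : ∀ x ∈ D, ∀ y ∈ D, u x = u y := fun x hx y hy =>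
    (hD.conn x hx y hy).eq_of_step fun a b hab ha hb => hstep a b hab (iff_of_true ha hb)
  have hout : ∀ x ∉ D, ∀ y ∉ D, u x = u y := fun x hx y hy =>
    (hD.coconn x hx y hy).eq_of_step fun a b hab ha hb => hstep a b hab (iff_of_false ha hb)
  refine Finset.Subset.antisymm hE fun e he => ?_
  have hχ₀ : χ e₀ = 1 := if_pos he₀
  have hne₀ := hu e₀
  by_contra heE
  have hχe : χ e = 0 := if_neg heE
  have hne := hu e
  rw [hχ₀] at hne₀
  rw [hχe, add_zero] at hne
  have h0 : u e₀.1 ≠ u (e₀.1 + unitVec e₀.2) := by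
    rw [hne₀]; intro h; exact one_ne_zero (left_eq_add.1 h)
  have m0 := mem_bdry.1 (hE he₀)
  have m1 := mem_bdry.1 he
  by_cases p0 : e₀.1 ∈ D <;> by_cases p1 : e.1 ∈ D <;>
    simp only [p0, p1, true_iff, false_iff, not_not] at m0 m1
  · exact h0 ((hin _ p0 _ p1).trans (hne.symm.trans (hout _ m1 _ m0)))
  · exact h0 ((hin _ p0 _ m1).trans (hne.trans (hout _ p1 _ m0)))
  · exact h0 ((hout _ p0 _ m1).trans (hne.trans (hin _ p1 _ m0)))
  · exact h0 ((hout _ p0 _ p1).trans (hne.symm.trans (hin _ m1 _ m0)))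

/-- A path inside `D` crosses no edge of `bdry D = bdry D'`, so it cannot leave `D'`. Hence counting
boundaries suffices to count blobs through a given site. -/
lemma Blob.subset_of_bdry_eq {D D' : Finset (ℤ × ℤ)} (hD : Blob D) {x : ℤ × ℤ} (hx : x ∈ D)
    (hx' : x ∈ D') (h : bdry D = bdry D') : D ⊆ D' := by
  intro y hy
  have := (hD.conn x hx y hy).eq_of_step (u := fun z => z ∈ D') ?_
  · exact this ▸ hx'
  intro a b hab ha hb
  obtain ⟨c, rfl | rfl⟩ := adj_iff_unitVec.1 hab
  · have : (a, c) ∉ bdry D' := h ▸ fun hm => mem_bdry.1 hm (iff_of_true ha hb)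
    exact propext (not_not.1 fun hn => this (mem_bdry.2 hn))
  · have : (b, c) ∉ bdry D' := h ▸ fun hm => mem_bdry.1 hm (iff_of_true hb ha)
    exact propext (not_not.1 fun hn => this (mem_bdry.2 hn)).symm

/-! ### Counting blobs by perimeter. -/

/-- Walk right from `x` up to the first exit. The sites passed have distinct first coordinates, so
the projection bound limits their number. -/
lemma exists_edge_right {D : Finset (ℤ × ℤ)} {x : ℤ × ℤ} (hx : x ∈ D) :
    ∃ k : ℕ, k ≤ per D ∧ (x + ((k : ℤ), 0), false) ∈ bdry D := by
  classical
  have hex : ∃ k : ℕ, x + ((k : ℤ), 0) ∉ D := by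
    by_contra! hall
    have : Set.Infinite (D : Set (ℤ × ℤ)) := by
      refine Set.infinite_of_injective_forall_mem (f := fun k : ℕ => x + ((k : ℤ), 0)) ?_ hall
      intro a b hab
      simpa using hab
    exact this D.finite_toSet
  have hpos : Nat.find hex ≠ 0 := fun h0 => by
    have := Nat.find_spec hex
    rw [h0] at this
    apply this
    have e : ((((0 : ℕ) : ℤ), 0) : ℤ × ℤ) = 0 := rfl
    rwa [e, add_zero]
  obtain ⟨m, hm⟩ := Nat.exists_eq_succ_of_ne_zero hpos
  have hin : ∀ i ≤ m, x + ((i : ℤ), 0) ∈ D := fun i hi => not_not.1 (Nat.find_min hex (by omega))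
  have hnot : x + (((m + 1 : ℕ) : ℤ), 0) ∉ D := by
    have := Nat.find_spec hex
    rwa [hm] at this
  refine ⟨m, ?_, mem_bdry.2 ?_⟩
  · have hc : m + 1 ≤ (D.image Prod.fst).card := by
      rw [← Finset.card_range (m + 1)]
      refine Finset.card_le_card_of_injOn (fun i => x.1 + i) ?_ ?_
      · intro i hi
        have := hin i (by simpa [Nat.lt_succ_iff] using hi)
        exact Finset.mem_coe.2 (Finset.mem_image.2 ⟨_, this, by simp⟩)
      · intro a _ b _ hab
        simpa using hab
    have := two_mul_projections_le_per D
    omega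
  · have e : x + ((m : ℤ), 0) + unitVec false = x + (((m + 1 : ℕ) : ℤ), 0) := by
      simp [unitVec, add_assoc]
    simp only [e]
    intro h
    exact hnot (h.1 (hin m le_rfl))

/-- Here `256 = 2 · 2^7`. The factor `2^7` pays for the animal bound with six neighbours per edge,
rooted at a boundary edge at distance `k` to the right of `x`. The remaining `2^(-per D) ≤ 2^(-k)`
pays for the choice of `k`. -/
lemma sum_blob_le (x : ℤ × ℤ) (𝒟 : Finset (Finset (ℤ × ℤ)))
    (h𝒟 : ∀ D ∈ 𝒟, x ∈ D ∧ Blob D) : ∑ D ∈ 𝒟, (1 / 256 : ℝ) ^ per D ≤ 2 := by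
  classical
  have hsel : ∀ D : Finset (ℤ × ℤ), ∃ k : ℕ, D ∈ 𝒟 →
      k ≤ per D ∧ (x + ((k : ℤ), 0), false) ∈ bdry D := by
    intro D
    by_cases hD : D ∈ 𝒟
    · obtain ⟨k, hk⟩ := exists_edge_right (h𝒟 D hD).1
      exact ⟨k, fun _ => hk⟩
    · exact ⟨0, fun h => absurd h hD⟩
  choose κ hκ using hsel
  have hfib : ∀ k : ℕ, ∑ D ∈ 𝒟.filter (fun D => κ D = k), (1 / 128 : ℝ) ^ (bdry D).card ≤ 1 := by
    intro k
    have hinj : Set.InjOn bdry (𝒟.filter (fun D => κ D = k) : Set (Finset (ℤ × ℤ))) := by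
      intro D hD D' hD' h
      have hD := (Finset.mem_filter.1 (Finset.mem_coe.1 hD)).1
      have hD' := (Finset.mem_filter.1 (Finset.mem_coe.1 hD')).1
      exact Finset.Subset.antisymm
        ((h𝒟 D hD).2.subset_of_bdry_eq (h𝒟 D hD).1 (h𝒟 D' hD').1 h)
        ((h𝒟 D' hD').2.subset_of_bdry_eq (h𝒟 D' hD').1 (h𝒟 D hD).1 h.symm)
    have := sum_connected_le plaqNbrs 6 card_plaqNbrs_le (x + ((k : ℤ), 0), false)
      ((𝒟.filter fun D => κ D = k).image bdry) ?_
    · rw [Finset.sum_image hinj] at this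
      norm_num at this ⊢
      exact this
    intro E hE
    obtain ⟨D, hD, rfl⟩ := Finset.mem_image.1 hE
    obtain ⟨hD', rfl⟩ := Finset.mem_filter.1 hD
    exact ⟨(hκ D hD').2, fun E₁ h1 h2 h3 => (h𝒟 D hD').2.bdry_connected h1 h2 h3⟩
  set M := (𝒟.image κ) with hM
  calc ∑ D ∈ 𝒟, (1 / 256 : ℝ) ^ per D
      ≤ ∑ D ∈ 𝒟, (1 / 2 : ℝ) ^ κ D * (1 / 128 : ℝ) ^ (bdry D).card := by
        refine Finset.sum_le_sum fun D hD => ?_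
        have : (1 / 256 : ℝ) ^ per D = (1 / 2) ^ per D * (1 / 128) ^ per D := by
          rw [← mul_pow]; norm_num
        rw [this]
        exact mul_le_mul (pow_le_pow_of_le_one (by norm_num) (by norm_num) (hκ D hD).1)
          (pow_le_pow_of_le_one (by norm_num) (by norm_num) (card_bdry_le D))
          (by positivity) (by positivity)
    _ = ∑ k ∈ M, ∑ D ∈ 𝒟.filter (fun D => κ D = k),
          (1 / 2 : ℝ) ^ κ D * (1 / 128 : ℝ) ^ (bdry D).card :=
        (Finset.sum_fiberwise_of_maps_to (fun D hD => Finset.mem_image_of_mem κ hD) _).symm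
    _ ≤ ∑ k ∈ M, (1 / 2 : ℝ) ^ k := by
        refine Finset.sum_le_sum fun k _ => ?_
        calc _ = (1 / 2 : ℝ) ^ k * ∑ D ∈ 𝒟.filter (fun D => κ D = k),
              (1 / 128 : ℝ) ^ (bdry D).card := by
              rw [Finset.mul_sum]
              refine Finset.sum_congr rfl fun D hD => ?_
              rw [(Finset.mem_filter.1 hD).2]
          _ ≤ _ := mul_le_of_le_one_right (by positivity) (hfib k)
    _ ≤ ∑' k : ℕ, (1 / 2 : ℝ) ^ k := summable_geometric_two.sum_le_tsum _ fun _ _ => by positivity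
    _ = 2 := tsum_geometric_two

/-! ### Contour interiors as components of the unreachable set. -/

lemma linked_line {A : Set (ℤ × ℤ)} {f : ℤ → ℤ × ℤ} (hf : ∀ k, Adj (f k) (f (k + 1))) {a b : ℤ}
    (hab : a ≤ b) (hA : ∀ k, a ≤ k → k ≤ b → f k ∈ A) : Linked A (f a) (f b) := by
  induction b, hab using Int.leInduction with
  | base => exact Relation.ReflTransGen.refl
  | succ m hm ih =>
    exact (ih fun k h1 h2 => hA k h1 (by omega)).tail
      ⟨hf m, hA m hm (by omega), hA (m + 1) (by omega) le_rfl⟩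

lemma linked_vertical {A : Set (ℤ × ℤ)} {a b c : ℤ} (hA : ∀ k, (a, k) ∈ A) :
    Linked A (a, b) (a, c) := by
  have hf : ∀ k : ℤ, Adj (a, k) (a, k + 1) := fun k => by simp [Adj]
  rcases le_total b c with h | h
  · exact linked_line (f := fun k => (a, k)) hf h fun k _ _ => hA k
  · exact (linked_line (f := fun k => (a, k)) hf h fun k _ _ => hA k).symm

lemma linked_horizontal {A : Set (ℤ × ℤ)} {a b c : ℤ} (hA : ∀ k, (k, a) ∈ A) :
    Linked A (b, a) (c, a) := by
  have hf : ∀ k : ℤ, Adj (k, a) (k + 1, a) := fun k => by simp [Adj]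
  rcases le_total b c with h | h
  · exact linked_line (f := fun k => (k, a)) hf h fun k _ _ => hA k
  · exact (linked_line (f := fun k => (k, a)) hf h fun k _ _ => hA k).symm

lemma linked_univ (x y : ℤ × ℤ) : Linked Set.univ x y :=
  (linked_vertical (a := x.1) (b := x.2) (c := y.2) fun _ => Set.mem_univ _).trans
    (linked_horizontal (a := y.2) (b := x.1) (c := y.1) fun _ => Set.mem_univ _)

lemma mem_box {n : ℕ} {x : ℤ × ℤ} : x ∈ box n ↔
    (-((n / 2 : ℕ) : ℤ) ≤ x.1 ∧ x.1 ≤ ((n / 2 : ℕ) : ℤ)) ∧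
      (-((n / 2 : ℕ) : ℤ) ≤ x.2 ∧ x.2 ≤ ((n / 2 : ℕ) : ℤ)) := by
  simp [box]

lemma linked_compl_box (n : ℕ) : ∀ x ∈ ((box n : Set (ℤ × ℤ))ᶜ), ∀ y ∈ ((box n : Set (ℤ × ℤ))ᶜ),
    Linked ((box n : Set (ℤ × ℤ))ᶜ) x y := by
  set m : ℤ := ((n / 2 : ℕ) : ℤ) with hm
  have hmem : ∀ x : ℤ × ℤ, x ∈ ((box n : Set (ℤ × ℤ))ᶜ) ↔
      x.1 < -m ∨ m < x.1 ∨ x.2 < -m ∨ m < x.2 := by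
    intro x
    rw [Set.mem_compl_iff, Finset.mem_coe, mem_box]
    omega
  have hcorner : ∀ x ∈ ((box n : Set (ℤ × ℤ))ᶜ),
      Linked ((box n : Set (ℤ × ℤ))ᶜ) x (m + 1, m + 1) := by
    rintro ⟨a, b⟩ hx
    have h1 : m < a ∨ a < -m → Linked ((box n : Set (ℤ × ℤ))ᶜ) (a, b) (m + 1, m + 1) := by
      intro ha
      refine (linked_vertical (c := m + 1) fun k => (hmem _).2 ?_).trans
        (linked_horizontal fun k => (hmem _).2 ?_) <;> simp only <;> omega
    have h2 : m < b ∨ b < -m → Linked ((box n : Set (ℤ × ℤ))ᶜ) (a, b) (m + 1, m + 1) := by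
      intro ha
      refine (linked_horizontal (c := m + 1) fun k => (hmem _).2 ?_).trans
        (linked_vertical fun k => (hmem _).2 ?_) <;> simp only <;> omega
    rw [hmem] at hx
    simp only at hx
    rcases hx with h | h | h | h
    · exact h1 (Or.inr h)
    · exact h1 (Or.inl h)
    · exact h2 (Or.inr h)
    · exact h2 (Or.inl h)
  exact fun x hx y hy => (hcorner x hx).trans (hcorner y hy).symm

lemma compl_box_nonempty (n : ℕ) : ((box n : Set (ℤ × ℤ))ᶜ).Nonempty :=
  ⟨(((n / 2 : ℕ) : ℤ) + 1, 0), fun h => by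
    have := (mem_box.1 (Finset.mem_coe.1 h)).1.2
    simp at this⟩

/-- The points that can be reached from `B` inside `A`. -/
def Reach (A B : Set (ℤ × ℤ)) : Set (ℤ × ℤ) := {y | ∃ b ∈ B, Linked A b y}

/-- The connected component of `x` in the set of points that cannot be reached from `B` in `A`. -/
def hole (A B : Set (ℤ × ℤ)) (x : ℤ × ℤ) : Set (ℤ × ℤ) := {y | Linked (Reach A B)ᶜ x y}

lemma subset_reach (A B : Set (ℤ × ℤ)) : B ⊆ Reach A B := fun b hb =>
  ⟨b, hb, Relation.ReflTransGen.refl⟩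

lemma reach_subset {A B : Set (ℤ × ℤ)} (hBA : B ⊆ A) : Reach A B ⊆ A := by
  rintro y ⟨b, hb, h⟩
  exact h.mem (hBA hb)

lemma mem_hole_self (A B : Set (ℤ × ℤ)) (x : ℤ × ℤ) : x ∈ hole A B x := Relation.ReflTransGen.refl

lemma hole_subset {A B : Set (ℤ × ℤ)} {x : ℤ × ℤ} (hx : x ∉ Reach A B) :
    hole A B x ⊆ (Reach A B)ᶜ := fun _ h => Linked.mem h hx

lemma hole_eq_of_mem {A B : Set (ℤ × ℤ)} {x y : ℤ × ℤ} (h : y ∈ hole A B x) :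
    hole A B y = hole A B x :=
  Set.ext fun _ => ⟨fun hz => Linked.trans h hz, fun hz => (Linked.symm h).trans hz⟩

lemma mem_hole_of_adj {A B : Set (ℤ × ℤ)} {x y z : ℤ × ℤ} (hx : x ∉ Reach A B)
    (hy : y ∈ hole A B x) (hz : z ∉ Reach A B) (hyz : Adj y z) : z ∈ hole A B x :=
  Relation.ReflTransGen.tail hy ⟨hyz, hole_subset hx hy, hz⟩

/-- Across the boundary of a hole the outer site is reached, hence in `A`, and the inner one is not
in `A`, since otherwise it would be reached too. With `A` a level set this is the contour condition.
-/
lemma exit_hole {A B : Set (ℤ × ℤ)} (hBA : B ⊆ A) {x y z : ℤ × ℤ} (hx : x ∉ Reach A B)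
    (hy : y ∈ hole A B x) (hz : z ∉ hole A B x) (hyz : Adj y z) :
    z ∈ Reach A B ∧ z ∈ A ∧ y ∉ A := by
  have hzR : z ∈ Reach A B := by
    by_contra hn
    exact hz (mem_hole_of_adj hx hy hn hyz)
  refine ⟨hzR, reach_subset hBA hzR, fun hyA => hole_subset hx hy ?_⟩
  obtain ⟨b, hb, h⟩ := hzR
  exact ⟨b, hb, h.tail ⟨hyz.symm, h.mem (hBA hb), hyA⟩⟩

lemma linked_hole {A B : Set (ℤ × ℤ)} {x y : ℤ × ℤ} (hy : y ∈ hole A B x) :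
    Linked (hole A B x) x y := by
  induction hy with
  | refl => exact Relation.ReflTransGen.refl
  | tail hb hbc ih => exact ih.tail ⟨hbc.1, hb, hb.tail hbc⟩

/-- The complement of a union of holes is connected. -/
lemma linked_compl_of_closed {A B F : Set (ℤ × ℤ)} (hB : ∀ x ∈ B, ∀ y ∈ B, Linked B x y)
    (hne : B.Nonempty) (hF : F ⊆ (Reach A B)ᶜ)
    (hcl : ∀ z ∉ Reach A B, ∀ z' ∈ F, Adj z z' → z ∈ F) :
    ∀ x ∉ F, ∀ y ∉ F, Linked Fᶜ x y := by
  obtain ⟨w, hw⟩ := hne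
  have hRF : Reach A B ⊆ Fᶜ := fun z hz hzF => hF hzF hz
  have hBF : B ⊆ Fᶜ := (subset_reach A B).trans hRF
  have hreach : ∀ z ∈ Reach A B, Linked Fᶜ z w := by
    rintro z ⟨b, hb, h⟩
    have h1 : Linked (Reach A B) b z := by
      induction h with
      | refl => exact Relation.ReflTransGen.refl
      | tail hbc hcd ih => exact ih.tail ⟨hcd.1, ⟨b, hb, hbc⟩, ⟨b, hb, hbc.tail hcd⟩⟩
    exact (h1.mono hRF).symm.trans ((hB b hb w hw).mono hBF)
  have key : ∀ z, z ∉ F → Linked Fᶜ z w := by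
    intro z
    -- Follow any lattice path to `w ∈ B`. As long as it has not met `Reach A B` it cannot enter
    -- `F`, because `F` contains every unreached neighbour of its sites; from `Reach A B` on, use a
    -- path inside that set.
    have hp := linked_univ z w
    induction hp using Relation.ReflTransGen.head_induction_on with
    | refl => exact fun _ => Relation.ReflTransGen.refl
    | @head a c hab _ ih =>
      intro ha
      by_cases haR : a ∈ Reach A B
      · exact hreach a haR
      · have hc : c ∉ F := fun hcF => ha (hcl a haR c hcF hab.1)
        exact Relation.ReflTransGen.head ⟨hab.1, ha, hc⟩ (ih hc)
  exact fun x hx y hy => (key x hx).trans (key y hy).symm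

lemma blob_of_hole {A B : Set (ℤ × ℤ)} (hB : ∀ x ∈ B, ∀ y ∈ B, Linked B x y)
    (hne : B.Nonempty) {x : ℤ × ℤ} (hx : x ∉ Reach A B) {D : Finset (ℤ × ℤ)}
    (hD : (D : Set (ℤ × ℤ)) = hole A B x) : Blob D := by
  constructor
  · intro y hy z hz
    rw [← Finset.mem_coe, hD] at hy hz
    rw [hD]
    exact (linked_hole hy).symm.trans (linked_hole hz)
  · have := linked_compl_of_closed (A := A) hB hne (F := D) (hD ▸ hole_subset hx) ?_
    · exact this
    · rw [hD]
      exact fun z hz z' hz' h => mem_hole_of_adj hx hz' hz h.symm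

noncomputable section

variable {n : ℕ}

/-! ### The gradient under raising and lowering inside a contour. -/

/-- Ordered pairs of neighbours in `Λ_n ∪ ∂Λ_n`. -/
def nbrPairs (n : ℕ) : Finset ((ℤ × ℤ) × (ℤ × ℤ)) :=
  ((box n ∪ outerBoundary n) ×ˢ (box n ∪ outerBoundary n)).filter fun q => Adj q.1 q.2

lemma gradient_eq (φ : Config n) : gradient φ =
    1 / 2 * ((∑ q ∈ nbrPairs n, |extend φ q.1 - extend φ q.2| : ℤ) : ℝ) := by
  rw [gradient, nbrPairs, Finset.sum_filter, Finset.sum_product]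
  push_cast
  rfl

lemma mem_union_outerBoundary_of_adj {x y : ℤ × ℤ} (hx : x ∈ box n) (h : Adj x y) :
    y ∈ box n ∪ outerBoundary n := by
  by_cases hy : y ∈ box n
  · exact Finset.mem_union_left _ hy
  · refine Finset.mem_union_right _ (Finset.mem_filter.2 ⟨?_, hy, x, hx, h.symm⟩)
    rw [mem_box] at hx ⊢
    have h' : |x.1 - y.1| + |x.2 - y.2| = 1 := h
    have h1 := abs_nonneg (x.1 - y.1)
    have h2 := abs_nonneg (x.2 - y.2)
    have h3 := abs_le.1 (show |x.1 - y.1| ≤ 1 by omega)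
    have h4 := abs_le.1 (show |x.2 - y.2| ≤ 1 by omega)
    have : ((n + 2) / 2 : ℕ) = n / 2 + 1 := by omega
    rw [this]
    push_cast
    omega

lemma mem_nbrPairs {x y : ℤ × ℤ} (hx : x ∈ box n) : (x, y) ∈ nbrPairs n ↔ Adj x y := by
  simp only [nbrPairs, Finset.mem_filter, Finset.mem_product]
  exact ⟨fun h => h.2, fun h => ⟨⟨Finset.mem_union_left _ hx,
    mem_union_outerBoundary_of_adj hx h⟩, h⟩⟩

lemma swap_mem_nbrPairs {q : (ℤ × ℤ) × (ℤ × ℤ)} : q.swap ∈ nbrPairs n ↔ q ∈ nbrPairs n := by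
  simp only [nbrPairs, Finset.mem_filter, Finset.mem_product, Prod.fst_swap, Prod.snd_swap]
  rw [adj_comm]
  tauto

lemma card_nbrPairs_fst {S : Finset (ℤ × ℤ)} (hS : S ⊆ box n) (P : ℤ × ℤ → Prop)
    [DecidablePred P] : ((nbrPairs n).filter fun q => q.1 ∈ S ∧ P q.2).card =
      ((S ×ˢ dirs).filter fun q => P (q.1 + q.2)).card := by
  symm
  refine Finset.card_bij (fun q _ => (q.1, q.1 + q.2)) ?_ ?_ ?_
  · rintro ⟨x, d⟩ h
    simp only [Finset.mem_filter, Finset.mem_product] at h ⊢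
    exact ⟨(mem_nbrPairs (hS h.1.1)).2 (adj_iff.2 ⟨d, h.1.2, rfl⟩), h.1.1, h.2⟩
  · rintro ⟨x, d⟩ _ ⟨y, e⟩ _ h
    simp only [Prod.mk.injEq] at h ⊢
    obtain ⟨rfl, h⟩ := h
    exact ⟨rfl, add_left_cancel h⟩
  · rintro ⟨x, y⟩ h
    simp only [Finset.mem_filter] at h
    obtain ⟨d, hd, rfl⟩ := adj_iff.1 ((mem_nbrPairs (hS h.2.1)).1 h.1)
    exact ⟨(x, d), Finset.mem_filter.2 ⟨Finset.mem_product.2 ⟨h.2.1, hd⟩, h.2.2⟩, rfl⟩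

lemma card_nbrPairs_swap (P : (ℤ × ℤ) × (ℤ × ℤ) → Prop) [DecidablePred P] :
    ((nbrPairs n).filter fun q => P q.swap).card = ((nbrPairs n).filter P).card := by
  refine Finset.card_bij (fun q _ => q.swap) ?_ ?_ ?_
  · intro q h
    rw [Finset.mem_filter] at h ⊢
    exact ⟨swap_mem_nbrPairs.2 h.1, h.2⟩
  · exact fun _ _ _ _ h => Prod.swap_injective h
  · intro q h
    rw [Finset.mem_filter] at h
    exact ⟨q.swap, Finset.mem_filter.2 ⟨swap_mem_nbrPairs.2 h.1, by simpa using h.2⟩, by simp⟩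

lemma sum_nbrPairs_boundary {D : Finset (ℤ × ℤ)} (hD : D ⊆ box n) :
    ∑ q ∈ nbrPairs n, (if q.1 ∈ D ↔ q.2 ∈ D then 0 else 1 : ℤ) = 2 * per D := by
  have h1 : ((nbrPairs n).filter fun q => q.1 ∈ D ∧ q.2 ∉ D).card = per D :=
    card_nbrPairs_fst hD fun y => y ∉ D
  have h2 : ((nbrPairs n).filter fun q => q.2 ∈ D ∧ q.1 ∉ D).card = per D :=
    (card_nbrPairs_swap fun q => q.1 ∈ D ∧ q.2 ∉ D).trans h1
  have : ∀ q ∈ nbrPairs n, (if q.1 ∈ D ↔ q.2 ∈ D then 0 else 1 : ℤ) =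
      (if q.1 ∈ D ∧ q.2 ∉ D then 1 else 0) + (if q.2 ∈ D ∧ q.1 ∉ D then 1 else 0) := by
    intro q _
    by_cases a : q.1 ∈ D <;> by_cases b : q.2 ∈ D <;> simp [a, b]
  rw [Finset.sum_congr rfl this, Finset.sum_add_distrib, ← Finset.natCast_card_filter,
    ← Finset.natCast_card_filter, h1, h2]
  ring

lemma sum_nbrPairs_incident {S : Finset (ℤ × ℤ)} (hS : S ⊆ box n) :
    ∑ q ∈ nbrPairs n, ((if q.1 ∈ S then 1 else 0) + (if q.2 ∈ S then 1 else 0) : ℤ) =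
      8 * S.card := by
  have h1 : ((nbrPairs n).filter fun q => q.1 ∈ S).card = 4 * S.card := by
    have := card_nbrPairs_fst hS fun _ => True
    simpa [Finset.card_product, card_dirs, mul_comm] using this
  have h2 : ((nbrPairs n).filter fun q => q.2 ∈ S).card = 4 * S.card :=
    (card_nbrPairs_swap fun q => q.1 ∈ S).trans h1
  rw [Finset.sum_add_distrib, ← Finset.natCast_card_filter,
    ← Finset.natCast_card_filter, h1, h2]
  push_cast
  ring

/-- The sites at height `0`. -/
def zeros (φ : Config n) : Finset (ℤ × ℤ) := (box n).filter fun x => extend φ x = 0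

/-- Raise `φ` by one on `T`. -/
def raiseOn (φ : Config n) (T : Finset (ℤ × ℤ)) : Config n :=
  fun x => φ x + if (x : ℤ × ℤ) ∈ T then 1 else 0

/-- Lower `φ` by one on `D`, but not below `0`. -/
def lowerOn (D : Finset (ℤ × ℤ)) (φ : Config n) : Config n :=
  fun x => if (x : ℤ × ℤ) ∈ D then max (φ x - 1) 0 else φ x

lemma extend_coe (φ : Config n) (x : box n) : extend φ x = φ x := by simp [extend]

lemma extend_of_notMem (φ : Config n) {x : ℤ × ℤ} (hx : x ∉ box n) : extend φ x = 0 := by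
  simp [extend, hx]

lemma config_ext {φ ψ : Config n} (h : ∀ x ∈ box n, extend φ x = extend ψ x) : φ = ψ := by
  funext x
  rw [← extend_coe φ, ← extend_coe ψ]
  exact h x x.2

lemma extend_raiseOn (φ : Config n) {T : Finset (ℤ × ℤ)} (hT : T ⊆ box n) (x : ℤ × ℤ) :
    extend (raiseOn φ T) x = extend φ x + if x ∈ T then 1 else 0 := by
  by_cases hx : x ∈ box n
  · simp [extend, hx, raiseOn]
  · simp [extend, hx, show x ∉ T from fun h => hx (hT h)]

lemma extend_lowerOn (D : Finset (ℤ × ℤ)) (φ : Config n) (x : ℤ × ℤ) :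
    extend (lowerOn D φ) x = if x ∈ D then max (extend φ x - 1) 0 else extend φ x := by
  by_cases hx : x ∈ box n
  · simp [extend, hx, lowerOn]
  · simp [extend, hx]

lemma extend_nonneg {φ : Config n} (hφ : ∀ x, 0 ≤ φ x) (x : ℤ × ℤ) : 0 ≤ extend φ x := by
  unfold extend
  split_ifs
  · exact hφ _
  · exact le_rfl

/-- `D` is surrounded by a contour that separates heights at most `h` inside from heights above `h`
outside. -/
def IsDown (D : Finset (ℤ × ℤ)) (h : ℤ) (φ : Config n) : Prop :=
  ∀ x ∈ D, ∀ y ∉ D, Adj x y → extend φ x ≤ h ∧ h + 1 ≤ extend φ y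

/-- `F` is surrounded by a contour that separates heights above `h` inside from heights at most `h`
outside. -/
def IsUp (F : Finset (ℤ × ℤ)) (h : ℤ) (φ : Config n) : Prop :=
  ∀ x ∈ F, ∀ y ∉ F, Adj x y → h + 1 ≤ extend φ x ∧ extend φ y ≤ h

/-- No two neighbours in `F` are at heights `0` and `≤ 1`. -/
def NoBad (F : Finset (ℤ × ℤ)) (φ : Config n) : Prop :=
  ∀ x ∈ F, ∀ y ∈ F, Adj x y → extend φ x ≤ 0 → 2 ≤ extend φ y

/-- Raising all of `D` shortens each boundary edge by one. Leaving a site of `S` behind costs at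
most one on each of its four edges. -/
lemma gradient_raiseOn_le {φ : Config n} {D S : Finset (ℤ × ℤ)} (hD : D ⊆ box n) (hS : S ⊆ D)
    {h : ℤ} (hφ : IsDown D h φ) :
    gradient (raiseOn φ (D \ S)) ≤ gradient φ - per D + 4 * S.card := by
  have key : ∑ q ∈ nbrPairs n, |extend (raiseOn φ (D \ S)) q.1 - extend (raiseOn φ (D \ S)) q.2| ≤
      ∑ q ∈ nbrPairs n, (|extend φ q.1 - extend φ q.2| - (if q.1 ∈ D ↔ q.2 ∈ D then 0 else 1) +
        ((if q.1 ∈ S then 1 else 0) + (if q.2 ∈ S then 1 else 0))) := by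
    refine Finset.sum_le_sum fun q hq => ?_
    obtain ⟨x, y⟩ := q
    have hadj : Adj x y := (Finset.mem_filter.1 hq).2
    rw [extend_raiseOn φ (Finset.sdiff_subset.trans hD),
      extend_raiseOn φ (Finset.sdiff_subset.trans hD)]
    simp only [Finset.mem_sdiff]
    have hxS := @hS x
    have hyS := @hS y
    by_cases hx : x ∈ D <;> by_cases hy : y ∈ D
    · by_cases sx : x ∈ S <;> by_cases sy : y ∈ S <;> simp [hx, hy, sx, sy]
      · have := abs_add_le (extend φ x - extend φ y) (-1)
        simp only [abs_neg, abs_one] at this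
        rwa [show extend φ x - (extend φ y + 1) = extend φ x - extend φ y + -1 by ring]
      · have := abs_add_le (extend φ x - extend φ y) 1
        simp only [abs_one] at this
        rwa [show extend φ x + 1 - extend φ y = extend φ x - extend φ y + 1 by ring]
    · have := hφ x hx y hy hadj
      have sy : y ∉ S := fun h => hy (hyS h)
      rw [abs_of_nonpos (a := extend φ x - extend φ y) (by omega)]
      by_cases sx : x ∈ S <;> simp [hx, hy, sx, sy]
      · rw [abs_of_nonpos (by omega)]
        omega
      · rw [abs_of_nonpos (by omega)]
        omega
    · have := hφ y hy x hx hadj.symm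
      have sx : x ∉ S := fun h => hx (hxS h)
      rw [abs_of_nonneg (a := extend φ x - extend φ y) (by omega)]
      by_cases sy : y ∈ S <;> simp [hx, hy, sx, sy]
      · rw [abs_of_nonneg (by omega)]
      · rw [abs_of_nonneg (by omega)]
        omega
    · have sx : x ∉ S := fun h => hx (hxS h)
      have sy : y ∉ S := fun h => hy (hyS h)
      simp [hx, hy, sx, sy]
  rw [Finset.sum_add_distrib, Finset.sum_sub_distrib, sum_nbrPairs_boundary hD,
    sum_nbrPairs_incident (hS.trans hD)] at key
  rw [gradient_eq, gradient_eq]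
  have key' := (Int.cast_le (R := ℝ)).2 key
  push_cast at key' ⊢
  linarith

/-- `NoBad` and `0 ≤ h` turn the cost of a site of `S` into a full four edges: its neighbours lie in
`F`, since a boundary site would have height at least `h + 1 > 0`, and are at height at least 2
after raising, so each incident difference grows by one. -/
lemma le_gradient_raiseOn {ψ : Config n} {F S : Finset (ℤ × ℤ)} (hF : F ⊆ box n) (hSF : S ⊆ F)
    {h : ℤ} (hh : 0 ≤ h) (hψ : ∀ x, 0 ≤ ψ x) (hS : S ⊆ zeros ψ)
    (hup : IsUp F h (raiseOn ψ (F \ S))) (hbad : NoBad F (raiseOn ψ (F \ S))) :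
    gradient ψ + per F + 4 * S.card ≤ gradient (raiseOn ψ (F \ S)) := by
  have key : ∑ q ∈ nbrPairs n, (|extend ψ q.1 - extend ψ q.2| +
        (if q.1 ∈ F ↔ q.2 ∈ F then 0 else 1) +
        ((if q.1 ∈ S then 1 else 0) + (if q.2 ∈ S then 1 else 0))) ≤
      ∑ q ∈ nbrPairs n,
        |extend (raiseOn ψ (F \ S)) q.1 - extend (raiseOn ψ (F \ S)) q.2| := by
    refine Finset.sum_le_sum fun q hq => ?_
    obtain ⟨x, y⟩ := q
    have hadj : Adj x y := (Finset.mem_filter.1 hq).2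
    have hb1 := hbad x
    have hb2 := hbad y
    have hu1 := hup x
    have hu2 := hup y
    have hx0 := extend_nonneg hψ x
    have hy0 := extend_nonneg hψ y
    have zx : x ∈ S → extend ψ x = 0 := fun h => (Finset.mem_filter.1 (hS h)).2
    have zy : y ∈ S → extend ψ y = 0 := fun h => (Finset.mem_filter.1 (hS h)).2
    simp only [extend_raiseOn ψ (Finset.sdiff_subset.trans hF)] at hb1 hb2 hu1 hu2 ⊢
    simp only [Finset.mem_sdiff] at hb1 hb2 hu1 hu2 ⊢
    by_cases hx : x ∈ F <;> by_cases hy : y ∈ F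
    · have hb1 := hb1 hx y hy hadj
      have hb2 := hb2 hy x hx hadj.symm
      by_cases sx : x ∈ S <;> by_cases sy : y ∈ S <;>
        simp [hx, hy, sx, sy] at hb1 hb2 ⊢
      · rw [zx sx, zy sy] at *; omega
      · rw [zx sx] at *
        rw [abs_of_nonpos (by omega), abs_of_nonpos (by omega)]; omega
      · rw [zy sy] at *
        rw [abs_of_nonneg (by omega), abs_of_nonneg (by omega)]; omega
    · have hu := hu1 hx y hy hadj
      have sy : y ∉ S := fun h => hy (hSF h)
      by_cases sx : x ∈ S <;> simp [hx, hy, sx, sy] at hu ⊢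
      · rw [zx sx] at hu; omega
      · rw [abs_of_nonneg (by omega), abs_of_nonneg (by omega)]; omega
    · have hu := hu2 hy x hx hadj.symm
      have sx : x ∉ S := fun h => hx (hSF h)
      by_cases sy : y ∈ S <;> simp [hx, hy, sx, sy] at hu ⊢
      · rw [zy sy] at hu; omega
      · rw [abs_of_nonpos (by omega), abs_of_nonpos (by omega)]; omega
    · have sx : x ∉ S := fun h => hx (hSF h)
      have sy : y ∉ S := fun h => hy (hSF h)
      simp [hx, hy, sx, sy]
  rw [Finset.sum_add_distrib, Finset.sum_add_distrib, sum_nbrPairs_boundary hF,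
    sum_nbrPairs_incident (hSF.trans hF)] at key
  rw [gradient_eq, gradient_eq]
  have key' := (Int.cast_le (R := ℝ)).2 key
  push_cast at key' ⊢
  linarith

lemma zeros_raiseOn {ψ : Config n} (hψ : ∀ x, 0 ≤ ψ x) {D S : Finset (ℤ × ℤ)} (hD : D ⊆ box n)
    (hS : S ⊆ zeros ψ ∩ D) : zeros (raiseOn ψ (D \ S)) = zeros ψ \ D ∪ S := by
  ext x
  have h0 := extend_nonneg hψ x
  have hSx := @hS x
  simp only [zeros, Finset.mem_filter, Finset.mem_union, Finset.mem_sdiff, Finset.mem_inter,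
    extend_raiseOn ψ (Finset.sdiff_subset.trans hD)] at hSx ⊢
  by_cases hx : x ∈ D <;> by_cases sx : x ∈ S <;> simp [hx, sx] at hSx ⊢
  · exact hSx
  · intro _; omega

lemma card_zeros_raiseOn {ψ : Config n} (hψ : ∀ x, 0 ≤ ψ x) {D S : Finset (ℤ × ℤ)}
    (hD : D ⊆ box n) (hS : S ⊆ zeros ψ ∩ D) :
    ((zeros (raiseOn ψ (D \ S))).card : ℝ) = (zeros ψ).card - (zeros ψ ∩ D).card + S.card := by
  rw [zeros_raiseOn hψ hD hS, Finset.card_union_of_disjoint]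
  · have := Finset.card_sdiff_add_card_inter (zeros ψ) D
    push_cast [← this]
    ring
  · rw [Finset.disjoint_left]
    exact fun x hx hxS => (Finset.mem_sdiff.1 hx).2 (Finset.mem_inter.1 (hS hxS)).2

lemma raiseOn_injOn (ψ : Config n) {D : Finset (ℤ × ℤ)} (hD : D ⊆ box n) :
    Set.InjOn (fun S => raiseOn ψ (D \ S)) {S | S ⊆ D} := by
  intro S hS S' hS' h
  have key : ∀ x, (x ∈ D \ S ↔ x ∈ D \ S') := by
    intro x
    have h1 := congrArg (fun φ => extend φ x) h
    simp only [extend_raiseOn ψ (Finset.sdiff_subset.trans hD)] at h1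
    by_cases a : x ∈ D \ S <;> by_cases b : x ∈ D \ S' <;> simp [a, b] at h1 ⊢
  have h2 : D \ S = D \ S' := Finset.ext key
  rw [← Finset.sdiff_sdiff_eq_self hS, h2, Finset.sdiff_sdiff_eq_self hS']

/-! ### The pinned weight and the contour maps. -/

open Classical in
/-- The weight `exp(-β ∑ |∇φ| + λ_w |{φ = 0}|)` of a non-negative height function. -/
def pinnedWeight (β : ℝ) (φ : Config n) : ℝ≥0∞ :=
  if ∀ x, 0 ≤ φ x then
    ENNReal.ofReal (Real.exp (-β * gradient φ + lamW β * ((zeros φ).card : ℝ)))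
  else 0

lemma pinnedWeight_of_not {β : ℝ} {φ : Config n} (h : ¬ ∀ x, 0 ≤ φ x) : pinnedWeight β φ = 0 :=
  if_neg h

open Classical in
/-- The total pinned weight of a set of height functions. -/
def mass (β : ℝ) (X : Set (Config n)) : ℝ≥0∞ := ∑' φ, if φ ∈ X then pinnedWeight β φ else 0

lemma mass_mono (β : ℝ) {X Y : Set (Config n)} (h : ∀ φ ∈ X, (∀ x, 0 ≤ φ x) → φ ∈ Y) :
    mass β X ≤ mass β Y := by
  refine ENNReal.tsum_le_tsum fun φ => ?_
  by_cases hX : φ ∈ X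
  · by_cases hφ : ∀ x, 0 ≤ φ x
    · simp [hX, h φ hX hφ]
    · simp [hX, pinnedWeight_of_not hφ]
  · simp [hX]

lemma mass_le_sum {ι : Type*} (β : ℝ) (s : Finset ι) {X : Set (Config n)} {Y : ι → Set (Config n)}
    (h : ∀ φ ∈ X, (∀ x, 0 ≤ φ x) → ∃ i ∈ s, φ ∈ Y i) : mass β X ≤ ∑ i ∈ s, mass β (Y i) := by
  classical
  unfold mass
  rw [← Summable.tsum_finsetSum fun i _ => ENNReal.summable]
  refine ENNReal.tsum_le_tsum fun φ => ?_
  by_cases hX : φ ∈ X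
  · by_cases hφ : ∀ x, 0 ≤ φ x
    · obtain ⟨i, hi, hY⟩ := h φ hX hφ
      refine le_trans ?_ (Finset.single_le_sum (fun _ _ => zero_le) hi)
      simp [hX, hY]
    · simp [hX, pinnedWeight_of_not hφ]
  · simp [hX]

/-- This identity characterises the critical pinning. A zero left behind has weight `exp(lamW β -
4β)` relative to a raised one, so both options together restore the reward lost by raising. -/
lemma one_add_exp_lamW {β : ℝ} (hβ : 0 < β) :
    Real.exp (lamW β - 4 * β) + 1 = Real.exp (lamW β) := by
  have h1 : Real.exp (-4 * β) < 1 := by rw [Real.exp_lt_one_iff]; linarith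
  have h2 : Real.exp (lamW β) = (1 - Real.exp (-4 * β))⁻¹ := by
    rw [lamW, Real.exp_neg, Real.exp_log (by linarith)]
  rw [show lamW β - 4 * β = lamW β + -4 * β by ring, Real.exp_add, h2]
  have : 1 - Real.exp (-4 * β) ≠ 0 := by linarith
  generalize Real.exp (-4 * β) = e at *
  field_simp
  ring

lemma sum_powerset_exp {β : ℝ} (hβ : 0 < β) (Z : Finset (ℤ × ℤ)) :
    ∑ S ∈ Z.powerset, Real.exp ((lamW β - 4 * β) * S.card) = Real.exp (lamW β * Z.card) := by
  have := Finset.sum_pow_mul_eq_add_pow (Real.exp (lamW β - 4 * β)) 1 Z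
  rw [one_add_exp_lamW hβ] at this
  simp only [one_pow, mul_one] at this
  have hpow : ∀ (a : ℝ) (k : ℕ), Real.exp (a * k) = Real.exp a ^ k := fun a k => by
    rw [mul_comm, Real.exp_nat_mul]
  simp only [hpow, this]

lemma raiseOn_nonneg {φ : Config n} (hφ : ∀ x, 0 ≤ φ x) (T : Finset (ℤ × ℤ)) (x : box n) :
    0 ≤ raiseOn φ T x := by
  have := hφ x
  unfold raiseOn
  split_ifs <;> omega

lemma lowerOn_raiseOn {φ : Config n} (hφ : ∀ x, 0 ≤ φ x) {D S : Finset (ℤ × ℤ)} (hD : D ⊆ box n)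
    (hS : S ⊆ zeros φ ∩ D) : lowerOn D (raiseOn φ (D \ S)) = φ := by
  refine config_ext fun x _ => ?_
  have h0 := extend_nonneg hφ x
  rw [extend_lowerOn, extend_raiseOn φ (Finset.sdiff_subset.trans hD)]
  by_cases hx : x ∈ D
  · by_cases sx : x ∈ S
    · have : extend φ x = 0 := (Finset.mem_filter.1 (Finset.mem_inter.1 (hS sx)).1).2
      simp [hx, sx, this]
    · simp [hx, sx, h0]
  · simp [hx]

-- The preimages `raiseOn φ (D \ S)`, with `S` running over subsets of the zeros of `φ` in `D`,
-- already carry enough weight: their sum over `S` is evaluated by `sum_powerset_exp`.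
open Classical in
lemma pinnedWeight_le_fibre {β : ℝ} (hβ : 0 < β) {D : Finset (ℤ × ℤ)} (hD : D ⊆ box n) {h : ℤ}
    {φ : Config n} (hφ : IsDown D h φ) :
    ENNReal.ofReal (Real.exp (β * per D)) * pinnedWeight β φ ≤
      ∑' φ', if lowerOn D φ' = φ then pinnedWeight β φ' else 0 := by
  by_cases h0 : ∀ x, 0 ≤ φ x
  swap
  · simp [pinnedWeight_of_not h0]
  set Z := zeros φ ∩ D with hZ
  have hinj : Set.InjOn (fun S => raiseOn φ (D \ S)) (Z.powerset : Set (Finset (ℤ × ℤ))) :=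
    (raiseOn_injOn φ hD).mono fun S hS =>
      (Finset.mem_powerset.1 (Finset.mem_coe.1 hS)).trans Finset.inter_subset_right
  refine le_trans ?_ (ENNReal.sum_le_tsum (Z.powerset.image fun S => raiseOn φ (D \ S)))
  rw [Finset.sum_image hinj]
  have hterm : ∀ S ∈ Z.powerset,
      ENNReal.ofReal (Real.exp (β * per D - β * gradient φ + lamW β * (zeros φ).card -
        lamW β * Z.card) * Real.exp ((lamW β - 4 * β) * S.card)) ≤
      (if lowerOn D (raiseOn φ (D \ S)) = φ then pinnedWeight β (raiseOn φ (D \ S)) else 0) := by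
    intro S hS
    have hS := Finset.mem_powerset.1 hS
    rw [if_pos (lowerOn_raiseOn h0 hD hS), pinnedWeight, if_pos (raiseOn_nonneg h0 _)]
    apply ENNReal.ofReal_le_ofReal
    rw [← Real.exp_add, Real.exp_le_exp, card_zeros_raiseOn h0 hD hS]
    have := gradient_raiseOn_le hD (hS.trans Finset.inter_subset_right) hφ
    nlinarith
  refine le_trans ?_ (Finset.sum_le_sum hterm)
  rw [← ENNReal.ofReal_sum_of_nonneg fun _ _ => by positivity, ← Finset.mul_sum,
    sum_powerset_exp hβ, pinnedWeight, if_pos h0, ← ENNReal.ofReal_mul (Real.exp_pos _).le,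
    ← Real.exp_add, ← Real.exp_add]
  apply ENNReal.ofReal_le_ofReal
  rw [Real.exp_le_exp]
  linarith

open Classical in
/-- Raising the heights inside a downward contour. -/
lemma mass_down_le {β : ℝ} (hβ : 0 < β) {D : Finset (ℤ × ℤ)} (hD : D ⊆ box n) {h : ℤ}
    {X : Set (Config n)} (hX : ∀ φ ∈ X, IsDown D h φ) :
    ENNReal.ofReal (Real.exp (β * per D)) * mass β X ≤ mass β {φ | lowerOn D φ ∈ X} := by
  calc ENNReal.ofReal (Real.exp (β * per D)) * mass β X
      ≤ ∑' φ, ∑' φ', if lowerOn D φ' = φ then (if φ ∈ X then pinnedWeight β φ' else 0) else 0 := by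
        rw [mass, ← ENNReal.tsum_mul_left]
        refine ENNReal.tsum_le_tsum fun φ => ?_
        by_cases hφ : φ ∈ X
        · simp only [hφ, if_true]
          exact pinnedWeight_le_fibre hβ hD (hX φ hφ)
        · simp [hφ]
    _ = ∑' φ', ∑' φ, if lowerOn D φ' = φ then (if φ ∈ X then pinnedWeight β φ' else 0) else 0 :=
        ENNReal.tsum_comm
    _ = mass β {φ | lowerOn D φ ∈ X} := by
        unfold mass
        refine tsum_congr fun φ' => ?_
        rw [tsum_eq_single (lowerOn D φ') fun φ hφ => if_neg fun h => hφ h.symm, if_pos rfl]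
        rfl

-- A non-negative preimage of `ψ` is determined by the set `S` of its zeros in `F`. The gradient
-- lower bound makes each weight at most the corresponding term of the binomial sum, which resums to
-- the weight of `ψ`.
open Classical in
lemma fibre_le_pinnedWeight {β : ℝ} (hβ : 0 < β) {F : Finset (ℤ × ℤ)} (hF : F ⊆ box n) {h : ℤ}
    (hh : 0 ≤ h) {X : Set (Config n)} (hX : ∀ φ ∈ X, IsUp F h φ ∧ NoBad F φ) (ψ : Config n) :
    ENNReal.ofReal (Real.exp (β * per F)) *
      ∑' φ, (if lowerOn F φ = ψ then (if φ ∈ X then pinnedWeight β φ else 0) else 0) ≤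
      pinnedWeight β ψ := by
  set g : Config n → ℝ≥0∞ := fun φ =>
    if lowerOn F φ = ψ then (if φ ∈ X then pinnedWeight β φ else 0) else 0 with hg
  have hg0 : ∀ φ, g φ ≠ 0 → lowerOn F φ = ψ ∧ φ ∈ X ∧ ∀ x, 0 ≤ φ x := by
    intro φ hφ
    by_contra hcon
    apply hφ
    simp only [hg]
    by_cases h1 : lowerOn F φ = ψ
    · by_cases h2 : φ ∈ X
      · have h3 : ¬ ∀ x, 0 ≤ φ x := fun h3 => hcon ⟨h1, h2, h3⟩
        simp [pinnedWeight_of_not h3]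
      · simp [h2]
    · simp [h1]
  have hbdry : ∀ φ, (∀ x, 0 ≤ φ x) → lowerOn F φ = ψ → ∀ x, 0 ≤ ψ x := by
    rintro φ hφ rfl x
    unfold lowerOn
    split_ifs
    · exact le_max_right _ _
    · exact hφ x
  by_cases h0 : ∀ x, 0 ≤ ψ x
  swap
  · have : ∀ φ, g φ = 0 := by
      intro φ
      by_contra hne
      obtain ⟨h1, h2, h3⟩ := hg0 φ hne
      exact h0 (hbdry φ h3 h1)
    rw [ENNReal.tsum_eq_zero.2 this, mul_zero]
    exact zero_le
  set Z := zeros ψ ∩ F with hZ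
  have hsupp : ∀ φ ∉ Z.powerset.image (fun S => raiseOn ψ (F \ S)), g φ = 0 := by
    intro φ hφ
    by_contra hne
    obtain ⟨h1, h2, h3⟩ := hg0 φ hne
    apply hφ
    refine Finset.mem_image.2 ⟨zeros φ ∩ F, Finset.mem_powerset.2 ?_, ?_⟩
    · intro x hx
      obtain ⟨hx1, hx2⟩ := Finset.mem_inter.1 hx
      refine Finset.mem_inter.2 ⟨Finset.mem_filter.2 ⟨hF hx2, ?_⟩, hx2⟩
      rw [← h1, extend_lowerOn, if_pos hx2, (Finset.mem_filter.1 hx1).2]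
      rfl
    · refine config_ext fun x hxb => ?_
      have hx0 := extend_nonneg h3 x
      rw [extend_raiseOn ψ (Finset.sdiff_subset.trans hF), ← h1, extend_lowerOn]
      by_cases hx : x ∈ F
      · by_cases hz : extend φ x = 0
        · have : x ∈ zeros φ := Finset.mem_filter.2 ⟨hxb, hz⟩
          simp [hx, hz, this]
        · have : x ∉ zeros φ := fun h => hz (Finset.mem_filter.1 h).2
          simp only [hx, if_true, Finset.mem_sdiff, Finset.mem_inter, this, false_and,
            not_false_eq_true, and_self]
          rw [max_eq_left (by omega)]
          ring
      · simp [hx]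
  have hinj : Set.InjOn (fun S => raiseOn ψ (F \ S)) (Z.powerset : Set (Finset (ℤ × ℤ))) :=
    (raiseOn_injOn ψ hF).mono fun S hS =>
      (Finset.mem_powerset.1 (Finset.mem_coe.1 hS)).trans Finset.inter_subset_right
  rw [tsum_eq_sum hsupp, Finset.sum_image hinj]
  have hterm : ∀ S ∈ Z.powerset, g (raiseOn ψ (F \ S)) ≤
      ENNReal.ofReal (Real.exp (-β * per F - β * gradient ψ + lamW β * (zeros ψ).card -
        lamW β * Z.card) * Real.exp ((lamW β - 4 * β) * S.card)) := by
    intro S hS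
    have hS := Finset.mem_powerset.1 hS
    by_cases hne : g (raiseOn ψ (F \ S)) = 0
    · rw [hne]; exact zero_le
    obtain ⟨h1, h2, h3⟩ := hg0 _ hne
    simp only [hg]
    rw [if_pos h1, if_pos h2, pinnedWeight, if_pos h3]
    apply ENNReal.ofReal_le_ofReal
    rw [← Real.exp_add, Real.exp_le_exp, card_zeros_raiseOn h0 hF hS]
    have := le_gradient_raiseOn hF (hS.trans Finset.inter_subset_right) hh h0
      (hS.trans Finset.inter_subset_left) (hX _ h2).1 (hX _ h2).2
    nlinarith
  refine le_trans (mul_le_mul_right (Finset.sum_le_sum hterm) _) ?_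
  rw [← ENNReal.ofReal_sum_of_nonneg fun _ _ => by positivity, ← Finset.mul_sum,
    sum_powerset_exp hβ, pinnedWeight, if_pos h0, ← ENNReal.ofReal_mul (Real.exp_pos _).le,
    ← Real.exp_add, ← Real.exp_add]
  apply ENNReal.ofReal_le_ofReal
  rw [Real.exp_le_exp]
  linarith

open Classical in
/-- Lowering the heights inside an upward contour. -/
lemma mass_up_le {β : ℝ} (hβ : 0 < β) {F : Finset (ℤ × ℤ)} (hF : F ⊆ box n) {h : ℤ}
    (hh : 0 ≤ h) {X : Set (Config n)} (hX : ∀ φ ∈ X, IsUp F h φ ∧ NoBad F φ) :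
    ENNReal.ofReal (Real.exp (β * per F)) * mass β X ≤ mass β (Set.univ : Set (Config n)) := by
  calc ENNReal.ofReal (Real.exp (β * per F)) * mass β X
      = ENNReal.ofReal (Real.exp (β * per F)) *
        ∑' φ, ∑' ψ, if lowerOn F φ = ψ then (if φ ∈ X then pinnedWeight β φ else 0) else 0 := by
        unfold mass
        congr 1
        refine tsum_congr fun φ => ?_
        rw [tsum_eq_single (lowerOn F φ) fun ψ hψ => if_neg fun h => hψ h.symm, if_pos rfl]
    _ = ∑' ψ, ENNReal.ofReal (Real.exp (β * per F)) *
        ∑' φ, if lowerOn F φ = ψ then (if φ ∈ X then pinnedWeight β φ else 0) else 0 := by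
        rw [ENNReal.tsum_comm, ENNReal.tsum_mul_left]
    _ ≤ mass β (Set.univ : Set (Config n)) := by
        unfold mass
        refine ENNReal.tsum_le_tsum fun ψ => ?_
        simpa using fibre_le_pinnedWeight hβ hF hh hX ψ

/-! ### From the relaxed measure to the pinned measure. -/

lemma tsum_pi_const (ι : Type*) [Fintype ι] (f : ℕ → ℝ≥0∞) :
    ∑' m : ι → ℕ, ∏ i, f (m i) = (∑' k, f k) ^ Fintype.card ι := by
  refine Fintype.induction_empty_option
    (P := fun ι _ => ∑' m : ι → ℕ, ∏ i, f (m i) = (∑' k, f k) ^ Fintype.card ι) ?_ ?_ ?_ ι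
  · intro α γ _ e ih
    let _ := Fintype.ofEquiv γ e.symm
    rw [← Fintype.card_congr e, ← ih, ← (e.arrowCongr (Equiv.refl ℕ)).tsum_eq]
    refine tsum_congr fun m => ?_
    rw [← Equiv.prod_comp e]
    simp
  · simp
  · intro α _ ih
    rw [Fintype.card_option, pow_succ', ← ih,
      ← (Equiv.piOptionEquivProd (β := fun _ : Option α => ℕ)).symm.tsum_eq, ENNReal.tsum_prod',
      ← ENNReal.tsum_mul_right]
    refine tsum_congr fun k => ?_
    rw [← ENNReal.tsum_mul_left]
    refine tsum_congr fun m => ?_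
    rw [Fintype.prod_option]
    rfl

lemma sum_nbrPairs_fst {w : ℤ × ℤ → ℤ} (hw : ∀ x ∉ box n, w x = 0) :
    ∑ q ∈ nbrPairs n, w q.1 = 4 * ∑ x ∈ box n, w x := by
  have h1 : ∑ q ∈ box n ×ˢ dirs, w q.1 = 4 * ∑ x ∈ box n, w x := by
    rw [Finset.sum_product, Finset.mul_sum]
    refine Finset.sum_congr rfl fun x _ => ?_
    simp [Finset.sum_const, card_dirs]
  have h2 : ∑ q ∈ (nbrPairs n).filter (fun q => q.1 ∈ box n), w q.1 = ∑ q ∈ nbrPairs n, w q.1 :=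
    Finset.sum_filter_of_ne fun q _ hq => by_contra fun h => hq (hw _ h)
  rw [← h1, ← h2]
  symm
  refine Finset.sum_bij (fun q _ => (q.1, q.1 + q.2)) ?_ ?_ ?_ fun _ _ => rfl
  · rintro ⟨x, d⟩ h
    obtain ⟨hx, hd⟩ := Finset.mem_product.1 h
    exact Finset.mem_filter.2 ⟨(mem_nbrPairs hx).2 (adj_iff.2 ⟨d, hd, rfl⟩), hx⟩
  · rintro ⟨x, d⟩ _ ⟨y, e⟩ _ h
    simp only [Prod.mk.injEq] at h ⊢
    obtain ⟨rfl, h⟩ := h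
    exact ⟨rfl, add_left_cancel h⟩
  · rintro ⟨x, y⟩ h
    obtain ⟨h, hx⟩ := Finset.mem_filter.1 h
    obtain ⟨d, hd, he⟩ := adj_iff.1 ((mem_nbrPairs hx).1 h)
    exact ⟨(x, d), Finset.mem_product.2 ⟨hx, hd⟩, Prod.ext rfl he.symm⟩

lemma sum_nbrPairs_snd {w : ℤ × ℤ → ℤ} (hw : ∀ x ∉ box n, w x = 0) :
    ∑ q ∈ nbrPairs n, w q.2 = 4 * ∑ x ∈ box n, w x := by
  rw [← sum_nbrPairs_fst hw]
  exact Finset.sum_bij (fun q _ => q.swap) (fun q hq => swap_mem_nbrPairs.2 hq)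
    (fun _ _ _ _ h => Prod.swap_injective h)
    (fun q hq => ⟨q.swap, swap_mem_nbrPairs.2 hq, by simp⟩) fun _ _ => rfl

/-- The positive part of a height function. -/
def posPart (φ : Config n) : Config n := fun x => max (φ x) 0

/-- The zeros without a neighbour in `Λ_n` at height `0`. -/
def isolated (ψ : Config n) : Finset (box n) :=
  Finset.univ.filter fun x => ψ x = 0 ∧ ∀ y : box n, Adj x y → ψ y ≠ 0

/-- The function with values `m` on the isolated zeros of `ψ`, and `0` elsewhere. -/
def depth (ψ : Config n) (m : isolated ψ → ℕ) : Config n :=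
  fun x => if h : x ∈ isolated ψ then (m ⟨x, h⟩ : ℤ) else 0

/-- Push each isolated zero `x` of `ψ` down to the height `- m x`. -/
def dig (ψ : Config n) (m : isolated ψ → ℕ) : Config n := fun x => ψ x - depth ψ m x

lemma depth_nonneg (ψ : Config n) (m : isolated ψ → ℕ) (x : box n) : 0 ≤ depth ψ m x := by
  unfold depth
  split_ifs
  · positivity
  · exact le_rfl

lemma mem_isolated {ψ : Config n} {x : box n} :
    x ∈ isolated ψ ↔ ψ x = 0 ∧ ∀ y : box n, Adj x y → ψ y ≠ 0 := by
  simp [isolated]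

lemma dig_nonpos_iff {ψ : Config n} (m : isolated ψ → ℕ) (x : box n) :
    dig ψ m x ≤ 0 ↔ ψ x ≤ 0 := by
  have h := depth_nonneg ψ m x
  by_cases hx : x ∈ isolated ψ
  · have := (mem_isolated.1 hx).1
    unfold dig
    omega
  · simp [dig, depth, hx]

lemma extend_dig (ψ : Config n) (m : isolated ψ → ℕ) (x : ℤ × ℤ) :
    extend (dig ψ m) x = extend ψ x - extend (depth ψ m) x := by
  by_cases hx : x ∈ box n
  · simp [extend, hx, dig]
  · simp [extend, hx]

lemma extend_depth_ne_zero {ψ : Config n} {m : isolated ψ → ℕ} {x : ℤ × ℤ}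
    (h : extend (depth ψ m) x ≠ 0) : ∃ hx : x ∈ box n, (⟨x, hx⟩ : box n) ∈ isolated ψ := by
  by_cases hx : x ∈ box n
  · refine ⟨hx, ?_⟩
    by_contra hn
    apply h
    simp [extend, hx, depth, hn]
  · exact absurd (extend_of_notMem _ hx) h

/-- Isolated zeros are pairwise non-adjacent and all their neighbours, including those on the outer
boundary, have height at least 0. Hence all four edges at such a zero grow by its full depth. -/
lemma gradient_dig {ψ : Config n} (hψ : ∀ x, 0 ≤ ψ x) (m : isolated ψ → ℕ) :
    gradient (dig ψ m) = gradient ψ + 4 * ∑ i, (m i : ℝ) := by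
  have key : ∑ q ∈ nbrPairs n, |extend (dig ψ m) q.1 - extend (dig ψ m) q.2| =
      ∑ q ∈ nbrPairs n, (|extend ψ q.1 - extend ψ q.2| +
        (extend (depth ψ m) q.1 + extend (depth ψ m) q.2)) := by
    refine Finset.sum_congr rfl fun q hq => ?_
    obtain ⟨x, y⟩ := q
    have hadj : Adj x y := (Finset.mem_filter.1 hq).2
    have hx0 := extend_nonneg hψ x
    have hy0 := extend_nonneg hψ y
    have hdx := extend_nonneg (depth_nonneg ψ m) x
    have hdy := extend_nonneg (depth_nonneg ψ m) y
    simp only [extend_dig]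
    by_cases hx : extend (depth ψ m) x = 0 <;> by_cases hy : extend (depth ψ m) y = 0
    · simp [hx, hy]
    · obtain ⟨hyb, hyi⟩ := extend_depth_ne_zero hy
      have h0 : extend ψ y = 0 := (extend_coe ψ ⟨y, hyb⟩).trans (mem_isolated.1 hyi).1
      rw [hx, h0, abs_of_nonneg (by omega), abs_of_nonneg (by omega)]
      ring
    · obtain ⟨hxb, hxi⟩ := extend_depth_ne_zero hx
      have h0 : extend ψ x = 0 := (extend_coe ψ ⟨x, hxb⟩).trans (mem_isolated.1 hxi).1
      rw [hy, h0, abs_of_nonpos (by omega), abs_of_nonpos (by omega)]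
      ring
    · obtain ⟨hyb, hyi⟩ := extend_depth_ne_zero hy
      obtain ⟨hxb, hxi⟩ := extend_depth_ne_zero hx
      exact absurd (mem_isolated.1 hyi).1 ((mem_isolated.1 hxi).2 ⟨y, hyb⟩ hadj)
  have hout : ∀ x ∉ box n, extend (depth ψ m) x = 0 := fun x hx => extend_of_notMem _ hx
  have hsum : ∑ x ∈ box n, extend (depth ψ m) x = ∑ i, (m i : ℤ) := by
    rw [← Finset.sum_coe_sort (box n)]
    simp only [extend_coe]
    rw [← Finset.sum_subset (Finset.subset_univ (isolated ψ)) fun x _ hx => by simp [depth, hx],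
      ← Finset.sum_coe_sort (isolated ψ)]
    refine Finset.sum_congr rfl fun i _ => ?_
    simp [depth]
  rw [Finset.sum_add_distrib, Finset.sum_add_distrib, sum_nbrPairs_fst hout,
    sum_nbrPairs_snd hout, hsum] at key
  rw [gradient_eq, gradient_eq, key]
  push_cast
  ring

lemma dig_mem_relaxedSpace {ψ : Config n} (hψ : ∀ x, 0 ≤ ψ x) (m : isolated ψ → ℕ) :
    dig ψ m ∈ relaxedSpace n := by
  rintro ⟨x, y, hxy, hx, hy⟩
  have hxi : x ∈ isolated ψ := by
    by_contra hn
    have := hψ x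
    simp [dig, depth, hn] at hx
    omega
  exact (mem_isolated.1 hxi).2 y hxy (le_antisymm ((dig_nonpos_iff m y).1 hy) (hψ y))

lemma Q2_dig (ψ : Config n) (m : isolated ψ → ℕ) : Q2 (dig ψ m) = Q2 ψ := by
  simp only [Q2, dig_nonpos_iff]

lemma posPart_dig {ψ : Config n} (hψ : ∀ x, 0 ≤ ψ x) (m : isolated ψ → ℕ) :
    posPart (dig ψ m) = ψ := by
  funext x
  have h := depth_nonneg ψ m x
  have h' := hψ x
  unfold posPart
  by_cases hx : x ∈ isolated ψ
  · have := (mem_isolated.1 hx).1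
    rw [this, max_eq_right]
    unfold dig
    omega
  · simp [dig, depth, hx, h']

lemma dig_injective (ψ : Config n) : Function.Injective (dig ψ) := by
  intro m m' h
  funext i
  have := congrFun h i
  simpa [dig, depth] using this

lemma exists_dig_eq {φ : Config n} (hφ : φ ∈ relaxedSpace n) :
    ∃ m, dig (posPart φ) m = φ := by
  refine ⟨fun i => (-φ i).toNat, funext fun x => ?_⟩
  by_cases hx : x ∈ isolated (posPart φ)
  · have h1 : max (φ x) 0 = 0 := (mem_isolated.1 hx).1
    have h2 : φ x ≤ 0 := max_eq_right_iff.1 h1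
    simp only [dig, depth, hx, dif_pos, posPart, h1]
    omega
  · simp only [dig, depth, hx, dif_neg, not_false_eq_true, sub_zero, posPart]
    refine max_eq_left ?_
    by_contra hneg
    apply hx
    refine mem_isolated.2 ⟨max_eq_right (by omega), fun y hxy hy => ?_⟩
    exact hφ ⟨x, y, hxy, by omega, max_eq_right_iff.1 hy⟩

lemma card_zeros_eq {ψ : Config n} (hψ : ∀ x, 0 ≤ ψ x) :
    (zeros ψ).card = (Q2 ψ).card + (isolated ψ).card := by
  classical
  have h1 : (zeros ψ).card = (Finset.univ.filter fun x : box n => ψ x = 0).card := by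
    symm
    refine Finset.card_bij (fun x _ => (x : ℤ × ℤ)) ?_ (fun _ _ _ _ h => Subtype.ext h) ?_
    · intro x hx
      exact Finset.mem_filter.2 ⟨x.2, (extend_coe ψ x).trans (Finset.mem_filter.1 hx).2⟩
    · intro x hx
      obtain ⟨hxb, hx0⟩ := Finset.mem_filter.1 hx
      exact ⟨⟨x, hxb⟩, Finset.mem_filter.2
        ⟨Finset.mem_univ _, (extend_coe ψ ⟨x, hxb⟩).symm.trans hx0⟩, rfl⟩
  have hz : ∀ x, ψ x ≤ 0 ↔ ψ x = 0 := fun x => ⟨fun h => le_antisymm h (hψ x), fun h => h.le⟩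
  rw [h1, ← Finset.card_union_of_disjoint]
  · congr 1
    ext x
    simp only [Q2, isolated, hz, Finset.mem_filter, Finset.mem_univ, true_and, Finset.mem_union]
    by_cases h : ∃ y : box n, Adj x y ∧ ψ y = 0
    · exact ⟨fun hx => Or.inl ⟨hx, h⟩, fun hx => hx.elim And.left And.left⟩
    · push Not at h
      constructor
      · exact fun hx => Or.inr ⟨hx, h⟩
      · rintro (⟨hx, -⟩ | ⟨hx, -⟩) <;> exact hx
  · rw [Finset.disjoint_left]
    intro x hx hx'
    obtain ⟨-, -, y, hxy, hy⟩ := Finset.mem_filter.1 hx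
    exact (mem_isolated.1 hx').2 y hxy ((hz y).1 hy)

lemma tsum_ofReal_exp {β : ℝ} (hβ : 0 < β) :
    ∑' k : ℕ, ENNReal.ofReal (Real.exp (-4 * β * k)) = ENNReal.ofReal (Real.exp (lamW β)) := by
  have h1 : Real.exp (-4 * β) < 1 := by rw [Real.exp_lt_one_iff]; linarith
  have hpow : ∀ k : ℕ, Real.exp (-4 * β * k) = Real.exp (-4 * β) ^ k := fun k => by
    rw [mul_comm, Real.exp_nat_mul]
  simp only [hpow]
  rw [← ENNReal.ofReal_tsum_of_nonneg (fun _ => by positivity)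
    (summable_geometric_of_lt_one (Real.exp_pos _).le h1),
    tsum_geometric_of_lt_one (Real.exp_pos _).le h1, lamW, Real.exp_neg,
    Real.exp_log (by linarith)]

-- The fibre is parametrised by independent depths on the isolated zeros. Each geometric series
-- equals `exp(lamW β)`, so an isolated zero earns the reward that `Q2` gives directly to the other
-- zeros.
open Classical in
lemma tsum_fibre_posPart {β : ℝ} (hβ : 0 < β) (ψ : Config n) :
    ∑' φ, (if posPart φ = ψ then relaxedWeight n β (lamW β) φ else 0) = pinnedWeight β ψ := by
  by_cases hψ : ∀ x, 0 ≤ ψ x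
  swap
  · rw [pinnedWeight_of_not hψ, ENNReal.tsum_eq_zero]
    intro φ
    refine if_neg ?_
    rintro rfl
    exact hψ fun x => le_max_right _ _
  have hsupp : Function.support
      (fun φ => if posPart φ = ψ then relaxedWeight n β (lamW β) φ else 0) ⊆
      Set.range (dig ψ) := by
    intro φ hφ
    by_cases h1 : posPart φ = ψ
    · by_cases h2 : φ ∈ relaxedSpace n
      · subst h1
        exact exists_dig_eq h2
      · exact absurd (by simp [relaxedWeight, h2]) hφ
    · exact absurd (by simp [h1]) hφ
  rw [← (dig_injective ψ).tsum_eq hsupp]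
  have hterm : ∀ m : isolated ψ → ℕ, (if posPart (dig ψ m) = ψ then
      relaxedWeight n β (lamW β) (dig ψ m) else 0) =
      ENNReal.ofReal (Real.exp (-β * gradient ψ + lamW β * (Q2 ψ).card)) *
        ∏ i, ENNReal.ofReal (Real.exp (-4 * β * m i)) := by
    intro m
    rw [if_pos (posPart_dig hψ m), relaxedWeight, if_pos (dig_mem_relaxedSpace hψ m), Q2_dig,
      gradient_dig hψ, ← ENNReal.ofReal_prod_of_nonneg fun _ _ => (Real.exp_pos _).le,
      ← Real.exp_sum, ← ENNReal.ofReal_mul (Real.exp_pos _).le, ← Real.exp_add, ← Finset.mul_sum]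
    congr 2
    ring
  simp only [hterm]
  rw [ENNReal.tsum_mul_left,
    tsum_pi_const _ fun k : ℕ => ENNReal.ofReal (Real.exp (-4 * β * k)), tsum_ofReal_exp hβ,
    pinnedWeight, if_pos hψ, Fintype.card_coe, ← ENNReal.ofReal_pow (Real.exp_pos _).le,
    ← Real.exp_nat_mul, ← ENNReal.ofReal_mul (Real.exp_pos _).le, ← Real.exp_add,
    card_zeros_eq hψ]
  congr 2
  push_cast
  ring

open Classical in
lemma tsum_relaxedWeight_eq_mass {β : ℝ} (hβ : 0 < β) (X : Set (Config n)) :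
    ∑' φ, (if posPart φ ∈ X then relaxedWeight n β (lamW β) φ else 0) = mass β X := by
  calc ∑' φ, (if posPart φ ∈ X then relaxedWeight n β (lamW β) φ else 0)
      = ∑' φ, ∑' ψ, if posPart φ = ψ then
          (if ψ ∈ X then relaxedWeight n β (lamW β) φ else 0) else 0 := by
        refine tsum_congr fun φ => ?_
        rw [tsum_eq_single (posPart φ) fun ψ hψ => if_neg fun h => hψ h.symm, if_pos rfl]
    _ = ∑' ψ, ∑' φ, if posPart φ = ψ then
          (if ψ ∈ X then relaxedWeight n β (lamW β) φ else 0) else 0 := ENNReal.tsum_comm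
    _ = mass β X := by
        unfold mass
        refine tsum_congr fun ψ => ?_
        by_cases hψ : ψ ∈ X
        · simp only [hψ, if_true]
          exact tsum_fibre_posPart hβ ψ
        · simp [hψ]

lemma mass_univ_eq {β : ℝ} (hβ : 0 < β) :
    mass β (Set.univ : Set (Config n)) = ∑' φ, relaxedWeight n β (lamW β) φ := by
  rw [← tsum_relaxedWeight_eq_mass hβ]
  simp

lemma mass_ne_top {β : ℝ} (hβ : 0 < β) (X : Set (Config n)) : mass β X ≠ ∞ :=
  ne_top_of_le_ne_top (mass_univ_eq hβ ▸ tsum_relaxedWeight_ne_top n hβ _)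
    (mass_mono β fun _ _ _ => Set.mem_univ _)

/-! ### Peierls estimates inside an upward contour. -/

/-- The total pinned weight of a set of height functions as a real number. -/
def rmass (β : ℝ) (X : Set (Config n)) : ℝ := (mass β X).toReal

lemma rmass_nonneg (β : ℝ) (X : Set (Config n)) : 0 ≤ rmass β X := ENNReal.toReal_nonneg

lemma rmass_mono {β : ℝ} (hβ : 0 < β) {X Y : Set (Config n)}
    (h : ∀ φ ∈ X, (∀ x, 0 ≤ φ x) → φ ∈ Y) : rmass β X ≤ rmass β Y :=
  ENNReal.toReal_mono (mass_ne_top hβ Y) (mass_mono β h)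

lemma rmass_le_sum {ι : Type*} {β : ℝ} (hβ : 0 < β) (s : Finset ι) {X : Set (Config n)}
    {Y : ι → Set (Config n)} (h : ∀ φ ∈ X, (∀ x, 0 ≤ φ x) → ∃ i ∈ s, φ ∈ Y i) :
    rmass β X ≤ ∑ i ∈ s, rmass β (Y i) := by
  unfold rmass
  rw [← ENNReal.toReal_sum fun i _ => mass_ne_top hβ (Y i)]
  exact ENNReal.toReal_mono (ENNReal.sum_ne_top.2 fun i _ => mass_ne_top hβ (Y i))
    (mass_le_sum β s h)

lemma rmass_le_add {β : ℝ} (hβ : 0 < β) {X Y Z : Set (Config n)}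
    (h : ∀ φ ∈ X, φ ∈ Y ∨ φ ∈ Z) : rmass β X ≤ rmass β Y + rmass β Z := by
  have := rmass_le_sum hβ Finset.univ (X := X) (Y := fun b : Bool => if b then Y else Z)
    fun φ hφ _ => (h φ hφ).elim (fun hY => ⟨true, Finset.mem_univ _, by simpa using hY⟩)
      fun hZ => ⟨false, Finset.mem_univ _, by simpa using hZ⟩
  simpa using this

lemma lowerOn_le {φ : Config n} (hφ : ∀ x, 0 ≤ φ x) (D : Finset (ℤ × ℤ)) (x : box n) :
    lowerOn D φ x ≤ φ x := by
  have := hφ x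
  unfold lowerOn
  split_ifs
  · omega
  · exact le_rfl

lemma extend_mono {φ ψ : Config n} (h : ∀ x, φ x ≤ ψ x) (x : ℤ × ℤ) :
    extend φ x ≤ extend ψ x := by
  unfold extend
  split_ifs
  · exact h _
  · exact le_rfl

lemma extend_le_lowerOn_add_one (φ : Config n) (D : Finset (ℤ × ℤ)) (x : ℤ × ℤ) :
    extend φ x ≤ extend (lowerOn D φ) x + 1 := by
  rw [extend_lowerOn]
  split_ifs <;> omega

/-- The Peierls estimate: summing over the downward contours in `𝒟`. -/
lemma rmass_le_sum_contours {β : ℝ} (hβ : 0 < β) {h : ℤ} {𝒟 : Finset (Finset (ℤ × ℤ))}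
    (h𝒟 : ∀ D ∈ 𝒟, D ⊆ box n) {X X' : Set (Config n)}
    (hX : ∀ φ ∈ X, (∀ x, 0 ≤ φ x) → ∃ D ∈ 𝒟, IsDown D h φ)
    (hX' : ∀ D ∈ 𝒟, ∀ φ, (∀ x, 0 ≤ φ x) → lowerOn D φ ∈ X → φ ∈ X') :
    rmass β X ≤ (∑ D ∈ 𝒟, Real.exp (-β * per D)) * rmass β X' := by
  refine (rmass_le_sum hβ 𝒟 (Y := fun D => {φ | φ ∈ X ∧ IsDown D h φ}) ?_).trans ?_
  · intro φ hφ h0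
    obtain ⟨D, hD, hd⟩ := hX φ hφ h0
    exact ⟨D, hD, hφ, hd⟩
  rw [Finset.sum_mul]
  refine Finset.sum_le_sum fun D hD => ?_
  have h1 := mass_down_le hβ (h𝒟 D hD) (X := {φ | φ ∈ X ∧ IsDown D h φ}) fun φ hφ => hφ.2
  have h2 := h1.trans (mass_mono β (Y := X') fun φ hφ h0 => hX' D hD φ h0 hφ.1)
  have h3 := ENNReal.toReal_mono (mass_ne_top hβ X') h2
  rw [ENNReal.toReal_mul, ENNReal.toReal_ofReal (Real.exp_pos _).le] at h3
  rw [neg_mul, Real.exp_neg, ← div_eq_inv_mul, le_div_iff₀ (Real.exp_pos _), mul_comm]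
  exact h3

/-- Spend `256^(-per D)` on entropy; the rest is monotone in the perimeter and is evaluated at the
minimal value `k`. -/
lemma sum_exp_per_le {β : ℝ} (hβ : 256 ≤ β) (x : ℤ × ℤ) {𝒟 : Finset (Finset (ℤ × ℤ))} {k : ℕ}
    (h𝒟 : ∀ D ∈ 𝒟, x ∈ D ∧ Blob D ∧ k ≤ per D) :
    ∑ D ∈ 𝒟, Real.exp (-β * per D) ≤ 2 * (256 * Real.exp (-β)) ^ k := by
  have hsmall : 256 * Real.exp (-β) ≤ 1 := by
    rw [Real.exp_neg, ← div_eq_mul_inv, div_le_one (Real.exp_pos _)]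
    linarith [Real.add_one_le_exp β]
  calc ∑ D ∈ 𝒟, Real.exp (-β * per D)
      ≤ ∑ D ∈ 𝒟, (1 / 256 : ℝ) ^ per D * (256 * Real.exp (-β)) ^ k := by
        refine Finset.sum_le_sum fun D hD => ?_
        have : Real.exp (-β * per D) = (1 / 256 : ℝ) ^ per D * (256 * Real.exp (-β)) ^ per D := by
          rw [← mul_pow, ← mul_assoc, mul_comm, Real.exp_nat_mul]
          norm_num
        rw [this]
        exact mul_le_mul_of_nonneg_left
          (pow_le_pow_of_le_one (by positivity) hsmall (h𝒟 D hD).2.2) (by positivity)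
    _ = (∑ D ∈ 𝒟, (1 / 256 : ℝ) ^ per D) * (256 * Real.exp (-β)) ^ k := by rw [Finset.sum_mul]
    _ ≤ _ := mul_le_mul_of_nonneg_right
        (sum_blob_le x 𝒟 fun D hD => ⟨(h𝒟 D hD).1, (h𝒟 D hD).2.1⟩) (by positivity)

/-- Inside an upward contour, a site at height at most `h` is surrounded by a downward contour. -/
lemma exists_down_contour {F : Finset (ℤ × ℤ)}
    (hco : ∀ x ∉ F, ∀ y ∉ F, Linked (F : Set (ℤ × ℤ))ᶜ x y) (hne : ∃ x, x ∉ F) {h : ℤ}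
    {φ : Config n} (hup : IsUp F h φ) {x : ℤ × ℤ} (hx : x ∈ F) (hxh : extend φ x ≤ h) :
    ∃ D ⊆ F, x ∈ D ∧ Blob D ∧ IsDown D h φ ∧
      ∀ y ∈ F, Adj x y → extend φ y ≤ h → y ∈ D := by
  classical
  set B : Set (ℤ × ℤ) := (F : Set (ℤ × ℤ))ᶜ with hB
  set A : Set (ℤ × ℤ) := {z | z ∉ F ∨ h + 1 ≤ extend φ z} with hA
  have hBA : B ⊆ A := fun z hz => Or.inl hz
  have hnot : ∀ z ∈ F, extend φ z ≤ h → z ∉ Reach A B := by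
    intro z hz hzh hzR
    rcases reach_subset hBA hzR with h1 | h1
    · exact h1 hz
    · omega
  have hxR := hnot x hx hxh
  have hsub : hole A B x ⊆ F := fun z hz => by
    by_contra hzF
    exact hole_subset hxR hz (subset_reach A B hzF)
  set D := F.filter fun z => z ∈ hole A B x with hD
  have hDh : (D : Set (ℤ × ℤ)) = hole A B x := by
    ext z
    simp only [hD, Finset.coe_filter, Set.mem_ofPred_eq]
    exact ⟨fun hz => hz.2, fun hz => ⟨hsub hz, hz⟩⟩
  have hmem : ∀ z, z ∈ D ↔ z ∈ hole A B x := fun z => by rw [← Finset.mem_coe, hDh]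
  refine ⟨D, Finset.filter_subset _ _, (hmem x).2 (mem_hole_self A B x),
    blob_of_hole (A := A) (B := B) hco hne hxR hDh, ?_, ?_⟩
  · intro z hz z' hz' hzz
    rw [hmem] at hz hz'
    obtain ⟨-, h2, h3⟩ := exit_hole hBA hxR hz hz' hzz
    have h4 : z ∈ F ∧ ¬ h + 1 ≤ extend φ z := by
      simpa [hA, not_or] using h3
    refine ⟨by omega, ?_⟩
    -- An exit through the boundary of `F` is impossible: `IsUp` would put the inner site above `h`.
    rcases h2 with h2 | h2
    · exact absurd (hup z h4.1 z' h2 hzz).1 h4.2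
    · exact h2
  · intro y hy hxy hyh
    exact (hmem y).2 (mem_hole_of_adj hxR (mem_hole_self A B x) (hnot y hy hyh) hxy)

/-- Events that are stable under raising the heights. -/
def Increasing (I : Set (Config n)) : Prop := ∀ φ ∈ I, ∀ ψ, (∀ x, φ x ≤ ψ x) → ψ ∈ I

lemma isUp_of_lowerOn {F D : Finset (ℤ × ℤ)} (hDF : D ⊆ F) {h : ℤ} {φ : Config n}
    (hφ : ∀ x, 0 ≤ φ x) (hup : IsUp F h (lowerOn D φ)) : IsUp F h φ := by
  intro x hx y hy hxy
  obtain ⟨h1, h2⟩ := hup x hx y hy hxy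
  refine ⟨h1.trans (extend_mono (lowerOn_le hφ D) x), ?_⟩
  rwa [extend_lowerOn, if_neg fun h => hy (hDF h)] at h2

lemma exp_ge_of_large {β : ℝ} (hβ : 2 ^ 14 ≤ β) : 4 * 256 ^ 8 ≤ Real.exp (2 * β) := by
  have h1 : (2 : ℝ) ^ 10 ≤ Real.exp (β / 16) := by
    have := Real.add_one_le_exp (β / 16)
    linarith
  have h2 : Real.exp (2 * β) = Real.exp (β / 16) ^ 32 := by
    rw [← Real.exp_nat_mul]
    congr 1
    push_cast
    ring
  rw [h2]
  refine le_trans ?_ (pow_le_pow_left₀ (by positivity) h1 32)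
  norm_num

/-- Inside an upward contour at level `h`, two given neighbours are rarely at heights `0` and
`≤ 1`, even conditionally on an increasing event. -/
lemma rmass_bad_le {β : ℝ} (hβ : 2 ^ 14 ≤ β) {F : Finset (ℤ × ℤ)} (hF : F ⊆ box n)
    (hco : ∀ x ∉ F, ∀ y ∉ F, Linked (F : Set (ℤ × ℤ))ᶜ x y) {h : ℕ} {I : Set (Config n)}
    (hI : Increasing I) {x y : ℤ × ℤ} (hx : x ∈ F) (hy : y ∈ F) (hxy : Adj x y) :
    rmass β {φ | (IsUp F h φ ∧ φ ∈ I) ∧ extend φ x ≤ 0 ∧ extend φ y ≤ 1} ≤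
      4 * 256 ^ 4 * Real.exp (-4 * β - 6 * β * h) * rmass β {φ | IsUp F h φ ∧ φ ∈ I} := by
  classical
  have hβ0 : 0 < β := lt_of_lt_of_le (by norm_num) hβ
  have hβ256 : 256 ≤ β := le_trans (by norm_num) hβ
  have hne : ∃ x, x ∉ F := by
    obtain ⟨z, hz⟩ := compl_box_nonempty n
    exact ⟨z, fun h => hz (hF h)⟩
  have hxney : x ≠ y := by
    rintro rfl
    simp [Adj] at hxy
  set Y : Set (Config n) := {φ | IsUp F h φ ∧ φ ∈ I} with hY
  -- `A h` is the bad event. In `A 0` only `x` is known to be at height at most `h`, which gives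
  -- perimeter 4; from `A 1` on the contour also encloses `y`, so its perimeter is at least 6.
  -- Raising inside a contour leads from `A (k + 1)` to `A k`.
  set A : ℕ → Set (Config n) := fun k =>
    {φ | φ ∈ Y ∧ extend φ x ≤ (h : ℤ) - k ∧ extend φ y ≤ (h : ℤ) - k + 1} with hA
  -- On `N` the contour can be taken to be the boundary of the pair, with no entropy, so each level
  -- costs exactly `exp(-6β)`. A constant factor per level would be fatal, as `h` grows like `log
  -- n`.
  set N : Set (Config n) := {φ | ∀ z ∈ ({x, y} : Finset (ℤ × ℤ)),
    ∀ z' ∉ ({x, y} : Finset (ℤ × ℤ)), Adj z z' → (h : ℤ) + 1 ≤ extend φ z'} with hN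
  have hYlow : ∀ D ⊆ F, ∀ φ : Config n, (∀ x, 0 ≤ φ x) → lowerOn D φ ∈ Y → φ ∈ Y :=
    fun D hD φ h0 hφ => ⟨isUp_of_lowerOn hD h0 hφ.1, hI _ hφ.2 φ (lowerOn_le h0 D)⟩
  have hAlow : ∀ k, ∀ D ⊆ F, ∀ φ : Config n, (∀ x, 0 ≤ φ x) → lowerOn D φ ∈ A (k + 1) →
      φ ∈ A k := by
    rintro k D hD φ h0 ⟨h1, h2, h3⟩
    have e1 := extend_le_lowerOn_add_one φ D x
    have e2 := extend_le_lowerOn_add_one φ D y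
    push_cast at h2 h3
    exact ⟨hYlow D hD φ h0 h1, by omega, by omega⟩
  have hdom : ({x, y} : Finset (ℤ × ℤ)) ⊆ F := by
    intro z hz
    rcases Finset.mem_insert.1 hz with rfl | hz
    · exact hx
    · rw [Finset.mem_singleton.1 hz]; exact hy
  set 𝒟 : Finset (Finset (ℤ × ℤ)) := F.powerset.filter fun D => x ∈ D ∧ Blob D with h𝒟
  have base : rmass β (A 0) ≤ 2 * (256 * Real.exp (-β)) ^ 4 * rmass β Y := by
    refine (rmass_le_sum_contours hβ0 (h := h) (𝒟 := 𝒟) (X' := Y) ?_ ?_ ?_).trans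
      (mul_le_mul_of_nonneg_right (sum_exp_per_le hβ256 x (k := 4) ?_) (rmass_nonneg _ _))
    · exact fun D hD => (Finset.mem_powerset.1 (Finset.mem_filter.1 hD).1).trans hF
    · rintro φ ⟨hφ, h1, -⟩ _
      obtain ⟨D, hDF, hxD, hb, hdown, -⟩ := exists_down_contour hco hne hφ.1 hx (by simpa using h1)
      exact ⟨D, Finset.mem_filter.2 ⟨Finset.mem_powerset.2 hDF, hxD, hb⟩, hdown⟩
    · exact fun D hD φ h0 hφ =>
        hYlow D (Finset.mem_powerset.1 (Finset.mem_filter.1 hD).1) φ h0 hφ.1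
    · intro D hD
      obtain ⟨-, hxD, hb⟩ := Finset.mem_filter.1 hD
      exact ⟨hxD, hb, four_le_per (Finset.card_pos.2 ⟨x, hxD⟩)⟩
  have stepd : ∀ k, rmass β (A (k + 1) ∩ N) ≤ Real.exp (-6 * β) * rmass β (A k ∩ N) := by
    intro k
    refine (rmass_le_sum_contours hβ0 (h := h) (𝒟 := {{x, y}}) (X' := A k ∩ N) ?_ ?_ ?_).trans
      (mul_le_mul_of_nonneg_right ?_ (rmass_nonneg _ _))
    · intro D hD
      rw [Finset.mem_singleton.1 hD]
      exact hdom.trans hF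
    · rintro φ ⟨⟨-, h1, h2⟩, h3⟩ _
      refine ⟨_, Finset.mem_singleton_self _, fun z hz z' hz' hzz => ⟨?_, h3 z hz z' hz' hzz⟩⟩
      push_cast at h1 h2
      rcases Finset.mem_insert.1 hz with rfl | hz
      · omega
      · rw [Finset.mem_singleton.1 hz]; omega
    · intro D hD φ h0 hφ
      rw [Finset.mem_singleton.1 hD] at hφ
      refine ⟨hAlow k _ hdom φ h0 hφ.1, fun z hz z' hz' hzz => ?_⟩
      have := hφ.2 z hz z' hz' hzz
      rwa [extend_lowerOn, if_neg hz'] at this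
    · rw [Finset.sum_singleton, Real.exp_le_exp]
      have : (6 : ℝ) ≤ per {x, y} := by
        exact_mod_cast six_le_per (by rw [Finset.card_pair hxney])
      nlinarith
  -- Off `N` the contour encloses at least three sites. It then has eight edges, and the spare
  -- `exp(-2β)` beyond the six needed per level beats the entropy; hence the constant in `hak` does
  -- not grow with `k`.
  have stepa : ∀ k, rmass β (A (k + 1)) ≤
      rmass β (A (k + 1) ∩ N) + 2 * (256 * Real.exp (-β)) ^ 8 * rmass β (A k) := by
    intro k
    set 𝒟' := 𝒟.filter fun D => 3 ≤ D.card with h𝒟'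
    have h𝒟F : ∀ D ∈ 𝒟', D ⊆ F := fun D hD =>
      Finset.mem_powerset.1 (Finset.mem_filter.1 (Finset.mem_filter.1 hD).1).1
    refine (rmass_le_add hβ0 (Y := A (k + 1) ∩ N)
      (Z := {φ | φ ∈ A (k + 1) ∧ ∃ D ∈ 𝒟', IsDown D h φ}) ?_).trans
      (add_le_add le_rfl ?_)
    · rintro φ ⟨hφ, h1, h2⟩
      push_cast at h1 h2
      obtain ⟨D, hDF, hxD, hb, hdown, hnbr⟩ :=
        exists_down_contour hco hne hφ.1 hx (by omega)
      have hyD := hnbr y hy hxy (by omega)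
      have hpair : ({x, y} : Finset (ℤ × ℤ)) ⊆ D := by
        intro z hz
        rcases Finset.mem_insert.1 hz with rfl | hz
        · exact hxD
        · rw [Finset.mem_singleton.1 hz]; exact hyD
      have hmemA : φ ∈ A (k + 1) := ⟨hφ, by push_cast; omega, by push_cast; omega⟩
      by_cases hc : 3 ≤ D.card
      · exact Or.inr ⟨hmemA, D, Finset.mem_filter.2 ⟨Finset.mem_filter.2
          ⟨Finset.mem_powerset.2 hDF, hxD, hb⟩, hc⟩, hdown⟩
      · have : {x, y} = D := Finset.eq_of_subset_of_card_le hpair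
          (by rw [Finset.card_pair hxney]; omega)
        subst this
        exact Or.inl ⟨hmemA, fun z hz z' hz' hzz => (hdown z hz z' hz' hzz).2⟩
    · refine (rmass_le_sum_contours hβ0 (h := h) (𝒟 := 𝒟') (X' := A k) ?_ ?_ ?_).trans
        (mul_le_mul_of_nonneg_right (sum_exp_per_le hβ256 x (k := 8) ?_) (rmass_nonneg _ _))
      · exact fun D hD => (h𝒟F D hD).trans hF
      · exact fun φ hφ _ => hφ.2
      · exact fun D hD φ h0 hφ => hAlow k D (h𝒟F D hD) φ h0 hφ.1
      · intro D hD
        obtain ⟨hD, hc⟩ := Finset.mem_filter.1 hD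
        obtain ⟨-, hxD, hb⟩ := Finset.mem_filter.1 hD
        exact ⟨hxD, hb, eight_le_per hc⟩
  set M := rmass β Y with hM
  have hM0 : 0 ≤ M := rmass_nonneg _ _
  set e := Real.exp (-β) with he
  have hepow : ∀ k : ℕ, Real.exp (-β * k) = e ^ k := fun k => by
    rw [mul_comm, Real.exp_nat_mul]
  have he6 : Real.exp (-6 * β) = e ^ 6 := by
    rw [← hepow]; congr 1; push_cast; ring
  have he0 : 0 < e := Real.exp_pos _
  have hdk : ∀ k, rmass β (A k ∩ N) ≤ 2 * 256 ^ 4 * e ^ (4 + 6 * k) * M := by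
    intro k
    induction k with
    | zero =>
      refine (rmass_mono hβ0 fun φ hφ _ => hφ.1).trans (base.trans (le_of_eq ?_))
      ring
    | succ k ih =>
      refine (stepd k).trans ?_
      rw [he6]
      refine (mul_le_mul_of_nonneg_left ih (by positivity)).trans (le_of_eq ?_)
      ring
  have hsmall : 4 * 256 ^ 8 * e ^ 2 ≤ 1 := by
    have h1 := exp_ge_of_large hβ
    have h2 : e ^ 2 = (Real.exp (2 * β))⁻¹ := by
      rw [← hepow, ← Real.exp_neg]; congr 1; push_cast; ring
    rw [h2, ← div_eq_mul_inv]
    exact div_le_one_of_le₀ h1 (Real.exp_pos _).le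
  have hak : ∀ k, rmass β (A k) ≤ 4 * 256 ^ 4 * e ^ (4 + 6 * k) * M := by
    intro k
    induction k with
    | zero =>
      have : 0 ≤ e ^ 4 * M := by positivity
      refine base.trans ?_
      simp only [mul_zero, add_zero, mul_pow]
      nlinarith
    | succ k ih =>
      refine (stepa k).trans ?_
      have h1 := hdk (k + 1)
      have h2 : 2 * (256 * e) ^ 8 * rmass β (A k) ≤
          2 * (256 * e) ^ 8 * (4 * 256 ^ 4 * e ^ (4 + 6 * k) * M) :=
        mul_le_mul_of_nonneg_left ih (by positivity)
      have h3 : 2 * (256 * e) ^ 8 * (4 * 256 ^ 4 * e ^ (4 + 6 * k) * M) =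
          (4 * 256 ^ 8 * e ^ 2) * (2 * 256 ^ 4 * e ^ (4 + 6 * (k + 1)) * M) := by ring
      have h4 : (4 * 256 ^ 8 * e ^ 2) * (2 * 256 ^ 4 * e ^ (4 + 6 * (k + 1)) * M) ≤
          2 * 256 ^ 4 * e ^ (4 + 6 * (k + 1)) * M :=
        mul_le_of_le_one_left (by positivity) hsmall
      linarith
  have hfin := hak h
  have hexp : Real.exp (-4 * β - 6 * β * h) = e ^ (4 + 6 * h) := by
    rw [← hepow]; congr 1; push_cast; ring
  rw [hexp]
  refine le_trans (rmass_mono hβ0 fun φ hφ _ => ?_) hfin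
  exact ⟨hφ.1, by simpa using hφ.2.1, by simpa using hφ.2.2⟩

lemma increasing_forall_not (P : Finset ((ℤ × ℤ) × (ℤ × ℤ))) : Increasing
    {φ : Config n | ∀ p ∈ P, ¬ (extend φ p.1 ≤ 0 ∧ extend φ p.2 ≤ 1)} := by
  intro φ hφ ψ hψ p hp hcon
  exact hφ p hp ⟨(extend_mono hψ p.1).trans hcon.1, (extend_mono hψ p.2).trans hcon.2⟩

/-- The absence of the pairs treated so far is an increasing event, so `rmass_bad_le` applies
conditionally on it and each further pair costs a factor `1 - ε`. No correlation inequality is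
needed. -/
lemma rmass_isUp_mul_le {β : ℝ} (hβ : 2 ^ 14 ≤ β) {F : Finset (ℤ × ℤ)} (hF : F ⊆ box n)
    (hco : ∀ x ∉ F, ∀ y ∉ F, Linked (F : Set (ℤ × ℤ))ᶜ x y) {h : ℕ} {ε : ℝ} (hε1 : ε ≤ 1)
    (hε : 4 * 256 ^ 4 * Real.exp (-4 * β - 6 * β * h) ≤ ε)
    (P : Finset ((ℤ × ℤ) × (ℤ × ℤ))) (hP : ∀ p ∈ P, p.1 ∈ F ∧ p.2 ∈ F ∧ Adj p.1 p.2) :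
    (1 - ε) ^ P.card * rmass β {φ : Config n | IsUp F h φ} ≤
      rmass β {φ : Config n | IsUp F h φ ∧
        φ ∈ {φ : Config n | ∀ p ∈ P, ¬ (extend φ p.1 ≤ 0 ∧ extend φ p.2 ≤ 1)}} := by
  classical
  have hβ0 : 0 < β := lt_of_lt_of_le (by norm_num) hβ
  induction P using Finset.induction_on with
  | empty =>
    simp
  | insert p P hp ih =>
    have ih := ih fun q hq => hP q (Finset.mem_insert_of_mem hq)
    obtain ⟨h1, h2, h3⟩ := hP p (Finset.mem_insert_self _ _)
    have hbad := rmass_bad_le hβ hF hco (h := h) (increasing_forall_not P) h1 h2 h3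
    set Y := {φ : Config n | IsUp F h φ ∧
        φ ∈ {φ : Config n | ∀ p ∈ P, ¬ (extend φ p.1 ≤ 0 ∧ extend φ p.2 ≤ 1)}} with hY
    have hsplit := rmass_le_add hβ0 (X := Y)
      (Y := {φ | φ ∈ Y ∧ extend φ p.1 ≤ 0 ∧ extend φ p.2 ≤ 1})
      (Z := {φ : Config n | IsUp F h φ ∧ φ ∈ {φ : Config n | ∀ q ∈ insert p P,
        ¬ (extend φ q.1 ≤ 0 ∧ extend φ q.2 ≤ 1)}}) ?_
    · have hbad' : rmass β {φ | φ ∈ Y ∧ extend φ p.1 ≤ 0 ∧ extend φ p.2 ≤ 1} ≤ ε * rmass β Y :=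
        hbad.trans (mul_le_mul_of_nonneg_right hε (rmass_nonneg _ _))
      rw [Finset.card_insert_of_notMem hp, pow_succ']
      have := mul_le_mul_of_nonneg_left ih (sub_nonneg.2 hε1)
      linarith
    · intro φ hφ
      by_cases hb : extend φ p.1 ≤ 0 ∧ extend φ p.2 ≤ 1
      · exact Or.inl ⟨hφ, hb⟩
      · refine Or.inr ⟨hφ.1, fun q hq => ?_⟩
        rcases Finset.mem_insert.1 hq with rfl | hq
        · exact hb
        · exact hφ.2 q hq

lemma exp_neg_two_mul_le {ε : ℝ} (h0 : 0 ≤ ε) (h1 : ε ≤ 1 / 2) : Real.exp (-(2 * ε)) ≤ 1 - ε := by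
  rw [Real.exp_neg]
  refine inv_le_of_inv_le₀ (by linarith) ?_
  refine le_trans ?_ (Real.add_one_le_exp (2 * ε))
  rw [inv_le_iff_one_le_mul₀ (by linarith)]
  nlinarith

/-- The probability of an upward contour. -/
lemma rmass_isUp_le {β : ℝ} (hβ : 2 ^ 14 ≤ β) {F : Finset (ℤ × ℤ)} (hF : F ⊆ box n)
    (hco : ∀ x ∉ F, ∀ y ∉ F, Linked (F : Set (ℤ × ℤ))ᶜ x y) {h : ℕ} (hn : 2 ^ 36 ≤ n)
    (hh : Real.exp (-4 * β - 6 * β * h) ≤ 1 / n) :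
    rmass β {φ : Config n | IsUp F h φ} ≤
      Real.exp (-(β - 2 ^ 38) * per F) * rmass β (Set.univ : Set (Config n)) := by
  classical
  have hβ0 : 0 < β := lt_of_lt_of_le (by norm_num) hβ
  have hnR : (2 : ℝ) ^ 36 ≤ n := by exact_mod_cast hn
  have hn0 : (0 : ℝ) < n := lt_of_lt_of_le (by norm_num) hnR
  -- `2^34 = 4 · 256^4` is the constant of `rmass_bad_le`.
  set ε : ℝ := 2 ^ 34 / n with hε
  have hε0 : 0 ≤ ε := by positivity
  have hε2 : ε ≤ 1 / 2 := by
    rw [hε, div_le_iff₀ hn0]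
    linarith
  have hεb : 4 * 256 ^ 4 * Real.exp (-4 * β - 6 * β * h) ≤ ε := by
    calc _ ≤ 4 * 256 ^ 4 * (1 / (n : ℝ)) := mul_le_mul_of_nonneg_left hh (by norm_num)
      _ = ε := by rw [hε]; ring
  set P := (F ×ˢ F).filter fun p => Adj p.1 p.2 with hP
  have hPmem : ∀ p, p ∈ P ↔ (p.1 ∈ F ∧ p.2 ∈ F) ∧ Adj p.1 p.2 := fun p => by
    rw [hP, Finset.mem_filter, Finset.mem_product]
  have h1 := rmass_isUp_mul_le hβ hF hco (h := h) (by linarith : ε ≤ 1) hεb P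
    fun p hp => ⟨((hPmem p).1 hp).1.1, ((hPmem p).1 hp).1.2, ((hPmem p).1 hp).2⟩
  have hPcard : P.card ≤ 4 * F.card := by
    have : P ⊆ (F ×ˢ dirs).image fun q => (q.1, q.1 + q.2) := by
      intro p hp
      obtain ⟨⟨a, -⟩, c⟩ := (hPmem p).1 hp
      obtain ⟨d, hd, hpd⟩ := adj_iff.1 c
      exact Finset.mem_image.2 ⟨(p.1, d), Finset.mem_product.2 ⟨a, hd⟩, by simp [← hpd]⟩
    refine (Finset.card_le_card this).trans (Finset.card_image_le.trans ?_)
    rw [Finset.card_product, card_dirs, mul_comm]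
  set X := {φ : Config n | IsUp F h φ ∧
    φ ∈ {φ : Config n | ∀ p ∈ P, ¬ (extend φ p.1 ≤ 0 ∧ extend φ p.2 ≤ 1)}} with hX
  have h2 := mass_up_le hβ0 hF (h := h) (Int.natCast_nonneg h) (X := X) ?_
  swap
  · rintro φ ⟨hup, hb⟩
    refine ⟨hup, fun x hx y hy hxy hx0 => ?_⟩
    have := hb (x, y) ((hPmem _).2 ⟨⟨hx, hy⟩, hxy⟩)
    simp only at this
    omega
  have h3 := ENNReal.toReal_mono (mass_ne_top hβ0 _) h2
  rw [ENNReal.toReal_mul, ENNReal.toReal_ofReal (Real.exp_pos _).le] at h3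
  change Real.exp (β * per F) * rmass β X ≤ rmass β Set.univ at h3
  set m := rmass β {φ : Config n | IsUp F h φ} with hm
  have hm0 : 0 ≤ m := rmass_nonneg _ _
  -- There are at most `4|F| ≤ 4n per F` pairs, each costing at most `exp(-2ε)`. The powers of `n`
  -- cancel.
  have h4 : Real.exp (-(2 ^ 38 * per F)) ≤ (1 - ε) ^ P.card := by
    have e1 : Real.exp (-(2 * ε)) ^ P.card ≤ (1 - ε) ^ P.card :=
      pow_le_pow_left₀ (Real.exp_pos _).le (exp_neg_two_mul_le hε0 hε2) _
    refine le_trans ?_ e1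
    rw [← Real.exp_nat_mul, Real.exp_le_exp]
    have e2 : (P.card : ℝ) ≤ 4 * F.card := by exact_mod_cast hPcard
    have e3 : 2 * (F.card : ℝ) ≤ (n + 1) * per F := by
      exact_mod_cast two_mul_card_le_of_subset_box hF
    have e4 : (P.card : ℝ) ≤ 4 * (n * per F) := by
      have : (n + 1 : ℝ) * per F ≤ 2 * n * per F :=
        mul_le_mul_of_nonneg_right (by linarith) (by positivity)
      linarith
    have e5 : (P.card : ℝ) * (2 * ε) ≤ 4 * (n * per F) * (2 * ε) :=
      mul_le_mul_of_nonneg_right e4 (by positivity)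
    have e6 : 4 * (n * per F) * (2 * ε) = 2 ^ 37 * (per F : ℝ) := by
      rw [hε]; field_simp; ring
    have e7 : (0 : ℝ) ≤ per F := by positivity
    linarith
  have h5 : Real.exp (β * per F) * (Real.exp (-(2 ^ 38 * per F)) * m) ≤ rmass β Set.univ :=
    le_trans (mul_le_mul_of_nonneg_left
      ((mul_le_mul_of_nonneg_right h4 hm0).trans h1) (Real.exp_pos _).le) h3
  rw [← mul_assoc, ← Real.exp_add] at h5
  have h6 : -(β - 2 ^ 38) * per F = -(β * per F + -(2 ^ 38 * per F)) := by ring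
  rw [h6, Real.exp_neg, ← div_eq_inv_mul, le_div_iff₀ (Real.exp_pos _), mul_comm]
  exact h5

/-! ### Outermost contours and the large deviation bound. -/

/-- The sites at height at most `h`, where the sites outside `Λ_n` have height `0`. -/
def lowSites (h : ℤ) (φ : Config n) : Set (ℤ × ℤ) := {z | extend φ z ≤ h}

open Classical in
/-- The interiors of the outermost contours at level `h`. -/
def comps (h : ℤ) (φ : Config n) : Finset (Finset (ℤ × ℤ)) :=
  (box n).powerset.filter fun D => ∃ x ∉ Reach (lowSites h φ) (box n : Set (ℤ × ℤ))ᶜ,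
    (D : Set (ℤ × ℤ)) = hole (lowSites h φ) (box n : Set (ℤ × ℤ))ᶜ x

lemma compl_box_subset_lowSites {h : ℤ} (hh : 0 ≤ h) (φ : Config n) :
    (box n : Set (ℤ × ℤ))ᶜ ⊆ lowSites h φ := fun z hz => by
  change extend φ z ≤ h
  rwa [extend_of_notMem φ hz]

lemma mem_comps {h : ℤ} {φ : Config n} {D : Finset (ℤ × ℤ)} (hD : D ∈ comps h φ) :
    D ⊆ box n ∧ ∃ x ∉ Reach (lowSites h φ) (box n : Set (ℤ × ℤ))ᶜ,
      (D : Set (ℤ × ℤ)) = hole (lowSites h φ) (box n : Set (ℤ × ℤ))ᶜ x := by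
  classical
  rw [comps, Finset.mem_filter, Finset.mem_powerset] at hD
  exact hD

lemma blob_of_mem_comps {h : ℤ} {φ : Config n} {D : Finset (ℤ × ℤ)} (hD : D ∈ comps h φ) :
    D ⊆ box n ∧ D.Nonempty ∧ Blob D := by
  obtain ⟨hb, x, hx, hDx⟩ := mem_comps hD
  refine ⟨hb, ⟨x, ?_⟩, blob_of_hole (linked_compl_box n) (compl_box_nonempty n) hx hDx⟩
  rw [← Finset.mem_coe, hDx]
  exact mem_hole_self _ _ x

lemma notMem_reach_of_mem_comps {h : ℤ} {φ : Config n} {D : Finset (ℤ × ℤ)} (hD : D ∈ comps h φ)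
    {y : ℤ × ℤ} (hy : y ∈ D) : y ∉ Reach (lowSites h φ) (box n : Set (ℤ × ℤ))ᶜ := by
  obtain ⟨-, x, hx, hDx⟩ := mem_comps hD
  rw [← Finset.mem_coe, hDx] at hy
  exact hole_subset hx hy

lemma mem_of_adj_of_mem_comps {h : ℤ} {φ : Config n} {D : Finset (ℤ × ℤ)} (hD : D ∈ comps h φ)
    {y z : ℤ × ℤ} (hy : y ∈ D) (hyz : Adj y z)
    (hz : z ∉ Reach (lowSites h φ) (box n : Set (ℤ × ℤ))ᶜ) : z ∈ D := by
  obtain ⟨-, x, hx, hDx⟩ := mem_comps hD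
  rw [← Finset.mem_coe, hDx] at hy ⊢
  exact mem_hole_of_adj hx hy hz hyz

lemma comps_disjoint {h : ℤ} {φ : Config n} {D D' : Finset (ℤ × ℤ)} (hD : D ∈ comps h φ)
    (hD' : D' ∈ comps h φ) (hne : D ≠ D') : Disjoint D D' := by
  rw [Finset.disjoint_left]
  intro y hy hy'
  obtain ⟨-, x, -, hDx⟩ := mem_comps hD
  obtain ⟨-, x', -, hDx'⟩ := mem_comps hD'
  rw [← Finset.mem_coe, hDx] at hy
  rw [← Finset.mem_coe, hDx'] at hy'
  apply hne
  rw [← Finset.coe_inj, hDx, hDx', ← hole_eq_of_mem hy, hole_eq_of_mem hy']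

lemma exists_mem_comps {h : ℤ} (hh : 0 ≤ h) {φ : Config n} {x : ℤ × ℤ}
    (hx : h + 1 ≤ extend φ x) : ∃ D ∈ comps h φ, x ∈ D := by
  classical
  have hxR : x ∉ Reach (lowSites h φ) (box n : Set (ℤ × ℤ))ᶜ := fun hm => by
    have : extend φ x ≤ h := reach_subset (compl_box_subset_lowSites hh φ) hm
    omega
  have hsub : hole (lowSites h φ) (box n : Set (ℤ × ℤ))ᶜ x ⊆ box n := fun z hz => by
    by_contra hzb
    exact hole_subset hxR hz (subset_reach _ _ hzb)
  have hcoe : (((box n).filter fun z => z ∈ hole (lowSites h φ) (box n : Set (ℤ × ℤ))ᶜ x :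
      Finset (ℤ × ℤ)) : Set (ℤ × ℤ)) = hole (lowSites h φ) (box n : Set (ℤ × ℤ))ᶜ x := by
    ext z
    simp only [Finset.coe_filter, Set.mem_ofPred_eq]
    exact ⟨fun hz => hz.2, fun hz => ⟨hsub hz, hz⟩⟩
  refine ⟨_, ?_, Finset.mem_coe.1 (hcoe ▸ mem_hole_self _ _ x)⟩
  rw [comps, Finset.mem_filter, Finset.mem_powerset]
  exact ⟨Finset.filter_subset _ _, x, hxR, hcoe⟩

/-- Distinct components of the unreachable set are never adjacent, so perimeters add up. A union of
them is still closed under unreached neighbours, which keeps its complement connected. -/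
lemma biUnion_comps {h : ℤ} {φ : Config n} {S : Finset (Finset (ℤ × ℤ))}
    (hS : S ⊆ comps h φ) :
    S.biUnion id ⊆ box n ∧
    (∀ x ∉ S.biUnion id, ∀ y ∉ S.biUnion id, Linked (S.biUnion id : Set (ℤ × ℤ))ᶜ x y) ∧
    per (S.biUnion id) = ∑ D ∈ S, per D := by
  classical
  have hmem : ∀ z, z ∈ S.biUnion id ↔ ∃ D ∈ S, z ∈ D := fun z => by simp
  refine ⟨Finset.biUnion_subset.2 fun D hD => (mem_comps (hS hD)).1, ?_, ?_⟩
  · have := linked_compl_of_closed (A := lowSites h φ) (linked_compl_box n) (compl_box_nonempty n)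
      (F := (S.biUnion id : Finset (ℤ × ℤ))) ?_ ?_
    · exact this
    · intro z hz
      obtain ⟨D, hD, hzD⟩ := (hmem z).1 hz
      exact notMem_reach_of_mem_comps (hS hD) hzD
    · intro z hz z' hz' hzz
      obtain ⟨D, hD, hzD⟩ := (hmem z').1 hz'
      exact (hmem z).2 ⟨D, hD, mem_of_adj_of_mem_comps (hS hD) hzD hzz.symm hz⟩
  · have : outPairs (S.biUnion id) = S.biUnion outPairs := by
      ext q
      obtain ⟨x, d⟩ := q
      simp only [outPairs, Finset.mem_filter, Finset.mem_product, Finset.mem_biUnion, id]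
      constructor
      · rintro ⟨⟨⟨D, hD, hx⟩, hd⟩, hn⟩
        exact ⟨D, hD, ⟨hx, hd⟩, fun h' => hn ⟨D, hD, h'⟩⟩
      · rintro ⟨D, hD, ⟨hx, hd⟩, hn⟩
        refine ⟨⟨⟨D, hD, hx⟩, hd⟩, ?_⟩
        rintro ⟨D', hD', hx'⟩
        exact hn (mem_of_adj_of_mem_comps (hS hD) hx (adj_iff.2 ⟨d, hd, rfl⟩)
          (notMem_reach_of_mem_comps (hS hD') hx'))
    rw [per, this, Finset.card_biUnion]
    · rfl
    · intro D hD D' hD' hne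
      refine Finset.disjoint_left.2 fun q hq hq' => ?_
      have h1 := (Finset.mem_product.1 (Finset.mem_filter.1 hq).1).1
      have h2 := (Finset.mem_product.1 (Finset.mem_filter.1 hq').1).1
      exact Finset.disjoint_left.1 (comps_disjoint (hS hD) (hS hD') hne) h1 h2

lemma isUp_biUnion_comps {h : ℤ} (hh : 0 ≤ h) {φ : Config n} {S : Finset (Finset (ℤ × ℤ))}
    (hS : S ⊆ comps h φ) : IsUp (S.biUnion id) h φ := by
  intro x hx y hy hxy
  obtain ⟨D, hD, hxD⟩ := Finset.mem_biUnion.1 hx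
  have hyD : y ∉ D := fun h' => hy (Finset.mem_biUnion.2 ⟨D, hD, h'⟩)
  obtain ⟨-, x₀, hx₀, hDx⟩ := mem_comps (hS hD)
  simp only [id] at hxD
  rw [← Finset.mem_coe, hDx] at hxD hyD
  obtain ⟨-, h2, h3⟩ := exit_hole (compl_box_subset_lowSites hh φ) hx₀ hxD hyD hxy
  have h4 : ¬ extend φ x ≤ h := h3
  exact ⟨by omega, h2⟩

/-- `rmass_isUp_le` needs only the complement of `F` to be connected, so it applies to the union of
`S`; additivity of the perimeter turns the bound into a product. -/
lemma rmass_subset_comps_le {β : ℝ} (hβ : 2 ^ 14 ≤ β) {h : ℕ} (hn : 2 ^ 36 ≤ n)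
    (hh : Real.exp (-4 * β - 6 * β * h) ≤ 1 / n) (S : Finset (Finset (ℤ × ℤ))) :
    rmass β {φ : Config n | S ⊆ comps h φ} ≤
      (∏ D ∈ S, Real.exp (-(β - 2 ^ 38) * per D)) * rmass β (Set.univ : Set (Config n)) := by
  have hβ0 : 0 < β := lt_of_lt_of_le (by norm_num) hβ
  have h0 : (0 : ℤ) ≤ h := Int.natCast_nonneg h
  by_cases hex : ∃ φ : Config n, S ⊆ comps h φ
  · obtain ⟨φ, hφ⟩ := hex
    obtain ⟨hF, hco, hper⟩ := biUnion_comps hφ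
    refine (rmass_mono hβ0 fun ψ hψ _ => isUp_biUnion_comps h0 hψ).trans
      ((rmass_isUp_le hβ hF hco hn hh).trans (le_of_eq ?_))
    rw [hper, ← Real.exp_sum, ← Finset.mul_sum]
    push_cast
    rfl
  · refine (rmass_mono hβ0 (Y := ∅) fun φ hφ _ => hex ⟨φ, hφ⟩).trans ?_
    have : rmass β (∅ : Set (Config n)) = 0 := by simp [rmass, mass]
    rw [this]
    exact mul_nonneg (Finset.prod_nonneg fun _ _ => (Real.exp_pos _).le) (rmass_nonneg _ _)

open Classical in
/-- Connected and co-connected non-empty subsets of `Λ_n`. -/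
def blobs (n : ℕ) : Finset (Finset (ℤ × ℤ)) :=
  (box n).powerset.filter fun D => D.Nonempty ∧ Blob D

lemma mem_blobs {D : Finset (ℤ × ℤ)} : D ∈ blobs n ↔ D ⊆ box n ∧ D.Nonempty ∧ Blob D := by
  simp [blobs]

lemma comps_subset_blobs (h : ℤ) (φ : Config n) : comps h φ ⊆ blobs n :=
  fun _ hD => mem_blobs.2 (blob_of_mem_comps hD)

/-- Exponential Markov inequality for functionals that are additive over outermost contours. -/
lemma rmass_mul_exp_le {β : ℝ} (hβ : 2 ^ 14 ≤ β) {h : ℕ} (hn : 2 ^ 36 ≤ n)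
    (hh : Real.exp (-4 * β - 6 * β * h) ≤ 1 / n) {g : Finset (ℤ × ℤ) → ℝ} (hg : ∀ D, 0 ≤ g D)
    {K : ℝ} {T : Set (Config n)} (hT : ∀ φ ∈ T, K ≤ ∑ D ∈ comps h φ, g D) :
    rmass β T * Real.exp K ≤
      Real.exp (∑ D ∈ blobs n, (Real.exp (g D) - 1) * Real.exp (-(β - 2 ^ 38) * per D)) *
        rmass β (Set.univ : Set (Config n)) := by
  classical
  have hβ0 : 0 < β := lt_of_lt_of_le (by norm_num) hβ
  set a : Finset (ℤ × ℤ) → ℝ := fun D => Real.exp (g D) - 1 with ha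
  have ha0 : ∀ D, 0 ≤ a D := fun D => by
    simpa [ha] using hg D
  have hpt : ENNReal.ofReal (Real.exp K) * mass β T ≤ ∑ S ∈ (blobs n).powerset,
      ENNReal.ofReal (∏ D ∈ S, a D) * mass β {φ : Config n | S ⊆ comps h φ} := by
    unfold mass
    simp only [← ENNReal.tsum_mul_left]
    rw [← Summable.tsum_finsetSum fun i _ => ENNReal.summable]
    refine ENNReal.tsum_le_tsum fun φ => ?_
    by_cases hφ : φ ∈ T
    swap
    · simp [hφ]
    -- Expand the product of `1 + a D` over the outermost contours, so that only the events `S ⊆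
    -- comps h φ` remain to be bounded.
    have h1 : Real.exp K ≤ ∑ S ∈ (comps h φ).powerset, ∏ D ∈ S, a D := by
      rw [← Finset.prod_one_add]
      simp only [ha, add_sub_cancel]
      rw [← Real.exp_sum, Real.exp_le_exp]
      exact hT φ hφ
    calc ENNReal.ofReal (Real.exp K) * (if φ ∈ T then pinnedWeight β φ else 0)
        ≤ ENNReal.ofReal (∑ S ∈ (comps h φ).powerset, ∏ D ∈ S, a D) * pinnedWeight β φ := by
          rw [if_pos hφ]
          exact mul_le_mul_left (ENNReal.ofReal_le_ofReal h1) _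
      _ = ∑ S ∈ (comps h φ).powerset, ENNReal.ofReal (∏ D ∈ S, a D) *
            (if φ ∈ {φ : Config n | S ⊆ comps h φ} then pinnedWeight β φ else 0) := by
          rw [ENNReal.ofReal_sum_of_nonneg fun S _ => Finset.prod_nonneg fun D _ => ha0 D,
            Finset.sum_mul]
          refine Finset.sum_congr rfl fun S hS => ?_
          rw [if_pos]
          exact Finset.mem_powerset.1 hS
      _ ≤ _ := by
          refine (Finset.sum_le_sum_of_subset
            (Finset.powerset_mono.2 (comps_subset_blobs h φ))).trans
            (le_of_eq (Finset.sum_congr rfl fun S _ => ?_))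
          congr
  have hne : ∀ S ∈ (blobs n).powerset,
      ENNReal.ofReal (∏ D ∈ S, a D) * mass β {φ : Config n | S ⊆ comps h φ} ≠ ∞ :=
    fun S _ => ENNReal.mul_ne_top ENNReal.ofReal_ne_top (mass_ne_top hβ0 _)
  have hreal := ENNReal.toReal_mono (ENNReal.sum_ne_top.2 hne) hpt
  rw [ENNReal.toReal_sum hne, ENNReal.toReal_mul, ENNReal.toReal_ofReal (Real.exp_pos _).le]
    at hreal
  have hR0 := rmass_nonneg β (Set.univ : Set (Config n))
  calc rmass β T * Real.exp K = Real.exp K * (mass β T).toReal := mul_comm _ _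
    _ ≤ ∑ S ∈ (blobs n).powerset, (∏ D ∈ S, a D) * rmass β {φ : Config n | S ⊆ comps h φ} := by
        refine hreal.trans (le_of_eq (Finset.sum_congr rfl fun S _ => ?_))
        rw [ENNReal.toReal_mul, ENNReal.toReal_ofReal (Finset.prod_nonneg fun D _ => ha0 D)]
        rfl
    _ ≤ ∑ S ∈ (blobs n).powerset, (∏ D ∈ S, a D * Real.exp (-(β - 2 ^ 38) * per D)) *
          rmass β (Set.univ : Set (Config n)) := by
        refine Finset.sum_le_sum fun S _ => ?_
        rw [Finset.prod_mul_distrib, mul_assoc]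
        exact mul_le_mul_of_nonneg_left (rmass_subset_comps_le hβ hn hh S)
          (Finset.prod_nonneg fun D _ => ha0 D)
    _ = (∏ D ∈ blobs n, (1 + a D * Real.exp (-(β - 2 ^ 38) * per D))) *
          rmass β (Set.univ : Set (Config n)) := by
        rw [Finset.prod_one_add, Finset.sum_mul]
    _ ≤ _ := by
        refine mul_le_mul_of_nonneg_right ?_ hR0
        rw [Real.exp_sum]
        refine Finset.prod_le_prod (fun D _ => ?_) fun D _ => ?_
        · have := mul_nonneg (ha0 D) (Real.exp_pos (-(β - 2 ^ 38) * per D)).le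
          linarith
        · rw [add_comm]
          exact Real.add_one_le_exp _

lemma sum_blobs_le {β : ℝ} (hβ : 256 ≤ β) :
    ∑ D ∈ blobs n, Real.exp (-β * per D) ≤ (n + 1) ^ 2 * (2 * (256 * Real.exp (-β)) ^ 4) := by
  classical
  have hsel : ∀ D : Finset (ℤ × ℤ), ∃ x : ℤ × ℤ, D ∈ blobs n → x ∈ D := by
    intro D
    by_cases hD : D ∈ blobs n
    · obtain ⟨x, hx⟩ := (mem_blobs.1 hD).2.1
      exact ⟨x, fun _ => hx⟩
    · exact ⟨0, fun h => absurd h hD⟩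
  choose ξ hξ using hsel
  have hmaps : ∀ D ∈ blobs n, ξ D ∈ box n := fun D hD => (mem_blobs.1 hD).1 (hξ D hD)
  rw [← Finset.sum_fiberwise_of_maps_to hmaps]
  have hfib : ∀ x ∈ box n, ∑ D ∈ (blobs n).filter (fun D => ξ D = x), Real.exp (-β * per D) ≤
      2 * (256 * Real.exp (-β)) ^ 4 := by
    intro x _
    refine sum_exp_per_le hβ x fun D hD => ?_
    obtain ⟨hDb, hDx⟩ := Finset.mem_filter.1 hD
    exact ⟨hDx ▸ hξ D hDb, (mem_blobs.1 hDb).2.2,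
      four_le_per (Finset.card_pos.2 (mem_blobs.1 hDb).2.1)⟩
  refine (Finset.sum_le_sum hfib).trans ?_
  rw [Finset.sum_const, nsmul_eq_mul]
  refine mul_le_mul_of_nonneg_right ?_ (by positivity)
  have : (box n).card ≤ (n + 1) ^ 2 := by
    rw [box, Finset.card_product, Int.card_Icc, sq]
    exact Nat.mul_le_mul (by omega) (by omega)
  exact_mod_cast this

/-- Uses `e^g - 1 ≤ g e^g` with `g = |D|/n ≤ per D` in the exponent and `|D| ≤ (per D)^2 ≤ exp(2 per
D)` in the prefactor. The retained `1/n` reduces a sum over `n^2` positions to order `n`. -/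
lemma exp_card_div_sub_one_le {D : Finset (ℤ × ℤ)} (hD : D ⊆ box n) (hn : 1 ≤ n) :
    Real.exp ((D.card : ℝ) / n) - 1 ≤ 1 / n * Real.exp (3 * per D) := by
  have hn' : (1 : ℝ) ≤ n := by exact_mod_cast hn
  set g : ℝ := (D.card : ℝ) / n with hg
  set p : ℝ := (per D : ℝ) with hp
  have hp0 : 0 ≤ p := by positivity
  have h1 : g ≤ p := by
    rw [hg, div_le_iff₀ (by linarith)]
    have h2 : 2 * (D.card : ℝ) ≤ (n + 1) * p := by
      rw [hp]; exact_mod_cast two_mul_card_le_of_subset_box hD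
    nlinarith
  have h2 : Real.exp g - 1 ≤ g * Real.exp g := by
    have h3 := Real.add_one_le_exp (-g)
    have h4 : Real.exp (-g) * Real.exp g = 1 := by rw [← Real.exp_add]; simp
    nlinarith [Real.exp_pos g]
  have h3 : (D.card : ℝ) ≤ Real.exp (2 * p) := by
    have h4 : (D.card : ℝ) ≤ p ^ 2 := by rw [hp]; exact_mod_cast card_le_per_sq D
    have h5 : p ≤ Real.exp p := by linarith [Real.add_one_le_exp p]
    have h6 : Real.exp (2 * p) = Real.exp p ^ 2 := by
      rw [← Real.exp_nat_mul]; norm_num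
    rw [h6]
    exact h4.trans (pow_le_pow_left₀ hp0 h5 2)
  calc Real.exp g - 1 ≤ g * Real.exp g := h2
    _ ≤ (Real.exp (2 * p) / n) * Real.exp p :=
        mul_le_mul (div_le_div_of_nonneg_right h3 (by linarith)) (Real.exp_le_exp.2 h1)
          (Real.exp_pos _).le (by positivity)
    _ = 1 / n * Real.exp (3 * p) := by
        rw [show 3 * p = 2 * p + p by ring, Real.exp_add]
        ring

/-- The large deviation bound for the pinned measure. -/
lemma rmass_many_high_le {β : ℝ} (hβ : 2 ^ 40 ≤ β) {h : ℕ} (hn : 2 ^ 36 ≤ n)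
    (hh : Real.exp (-4 * β - 6 * β * h) ≤ 1 / n) :
    rmass β {φ : Config n | Real.exp (-β) * (n : ℝ) ^ 2 ≤
      ((Finset.univ.filter fun x : box n => (h : ℤ) + 1 ≤ φ x).card : ℝ)} ≤
      Real.exp (-(Real.exp (-β) / 2 * n)) * rmass β (Set.univ : Set (Config n)) := by
  classical
  have h0 : (0 : ℤ) ≤ h := Int.natCast_nonneg h
  have hnR : (2 : ℝ) ^ 36 ≤ n := by exact_mod_cast hn
  have hn0 : (0 : ℝ) < n := lt_of_lt_of_le (by norm_num) hnR
  set T : Set (Config n) := {φ : Config n | Real.exp (-β) * (n : ℝ) ^ 2 ≤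
      ((Finset.univ.filter fun x : box n => (h : ℤ) + 1 ≤ φ x).card : ℝ)} with hT
  have hmain := rmass_mul_exp_le (β := β) (le_trans (by norm_num) hβ) hn hh
    (g := fun D => (D.card : ℝ) / n) (fun D => by positivity) (K := Real.exp (-β) * n) (T := T) ?_
  swap
  · intro φ hφ
    have hcard : (Finset.univ.filter fun x : box n => (h : ℤ) + 1 ≤ φ x).card ≤
        ∑ D ∈ comps h φ, D.card := by
      refine le_trans ?_ (Finset.card_biUnion_le (s := comps h φ) (t := id))
      refine Finset.card_le_card_of_injOn (fun x => (x : ℤ × ℤ)) ?_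
        fun _ _ _ _ h => Subtype.ext h
      intro x hx
      have hx' := (Finset.mem_filter.1 (Finset.mem_coe.1 hx)).2
      obtain ⟨D, hD, hxD⟩ := exists_mem_comps h0 (φ := φ) (x := x) (by rwa [extend_coe])
      exact Finset.mem_coe.2 (Finset.mem_biUnion.2 ⟨D, hD, hxD⟩)
    rw [← Finset.sum_div, le_div_iff₀ hn0]
    have hφ' : Real.exp (-β) * (n : ℝ) ^ 2 ≤
      ((Finset.univ.filter fun x : box n => (h : ℤ) + 1 ≤ φ x).card : ℝ) := hφ
    calc Real.exp (-β) * n * n = Real.exp (-β) * (n : ℝ) ^ 2 := by ring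
      _ ≤ _ := hφ'
      _ ≤ _ := by exact_mod_cast hcard
  -- The effective inverse temperature: `2^38` is lost to bad pairs and `3` to the exponential
  -- moment. Every contour has at least four edges, so the sum is of order `n exp(-4γ)`, below half
  -- of the exponent `K`.
  set γ : ℝ := β - 2 ^ 38 - 3 with hγ
  have hsum : ∑ D ∈ blobs n, (Real.exp ((D.card : ℝ) / n) - 1) *
      Real.exp (-(β - 2 ^ 38) * per D) ≤ Real.exp (-β) / 2 * n := by
    calc ∑ D ∈ blobs n, (Real.exp ((D.card : ℝ) / n) - 1) * Real.exp (-(β - 2 ^ 38) * per D)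
        ≤ ∑ D ∈ blobs n, 1 / n * Real.exp (-γ * per D) := by
          refine Finset.sum_le_sum fun D hD => ?_
          have h1 := exp_card_div_sub_one_le (mem_blobs.1 hD).1 (le_trans (by norm_num) hn)
          have h2 : Real.exp (-γ * per D) =
              Real.exp (3 * per D) * Real.exp (-(β - 2 ^ 38) * per D) := by
            rw [← Real.exp_add, hγ]
            congr 1
            ring
          rw [h2, ← mul_assoc]
          exact mul_le_mul_of_nonneg_right h1 (Real.exp_pos _).le
      _ ≤ 1 / n * ((n + 1) ^ 2 * (2 * (256 * Real.exp (-γ)) ^ 4)) := by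
          rw [← Finset.mul_sum]
          exact mul_le_mul_of_nonneg_left (sum_blobs_le (by rw [hγ]; linarith)) (by positivity)
      _ ≤ 1 / n * ((2 * n) ^ 2 * (2 * (256 * Real.exp (-γ)) ^ 4)) := by
          refine mul_le_mul_of_nonneg_left (mul_le_mul_of_nonneg_right
            (pow_le_pow_left₀ (by positivity) (by linarith) 2) (by positivity)) (by positivity)
      _ = n * (2 ^ 35 * Real.exp (-γ) ^ 4) := by
          field_simp
          ring
      _ ≤ Real.exp (-β) / 2 * n := by
          rw [mul_comm]
          refine mul_le_mul_of_nonneg_right ?_ hn0.le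
          have h1 : (2 : ℝ) ^ 36 ≤ Real.exp (4 * γ - β) := by
            have := Real.add_one_le_exp (4 * γ - β)
            have h2 : (2 : ℝ) ^ 36 ≤ 4 * γ - β + 1 := by rw [hγ]; linarith
            linarith
          have h2 : Real.exp (-β) = Real.exp (4 * γ - β) * Real.exp (-γ) ^ 4 := by
            rw [← Real.exp_nat_mul, ← Real.exp_add]
            congr 1
            push_cast
            ring
          rw [h2]
          have h3 : 0 < Real.exp (-γ) ^ 4 := by positivity
          nlinarith
  have hR0 := rmass_nonneg β (Set.univ : Set (Config n))
  have hfin := hmain.trans (mul_le_mul_of_nonneg_right (Real.exp_le_exp.2 hsum) hR0)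
  have h1 : Real.exp (-(Real.exp (-β) / 2 * n)) =
      Real.exp (Real.exp (-β) / 2 * n) / Real.exp (Real.exp (-β) * n) := by
    rw [← Real.exp_sub]
    congr 1
    ring
  rw [h1, div_mul_eq_mul_div, le_div_iff₀ (Real.exp_pos _)]
  exact hfin

lemma toMeasure_le {β : ℝ} (hβ : 0 < β) {T : Set (Config n)}
    (hT : ∀ φ : Config n, φ ∈ T ↔ posPart φ ∈ T) {c : ℝ} (hc : 0 ≤ c)
    (h : rmass β T ≤ c * rmass β (Set.univ : Set (Config n))) :
    (relaxedSOS n β hβ (lamW β)).toMeasure T ≤ ENNReal.ofReal c := by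
  classical
  set Z := ∑' φ, relaxedWeight n β (lamW β) φ with hZ
  have hZ0 : Z ≠ 0 := tsum_relaxedWeight_ne_zero n β (lamW β)
  have hZt : Z ≠ ∞ := tsum_relaxedWeight_ne_top n hβ (lamW β)
  have h1 : (relaxedSOS n β hβ (lamW β)).toMeasure T = mass β T * Z⁻¹ := by
    rw [PMF.toMeasure_apply_eq_tsum, ← tsum_relaxedWeight_eq_mass hβ, ← ENNReal.tsum_mul_right]
    refine tsum_congr fun φ => ?_
    by_cases hφ : φ ∈ T
    · rw [Set.indicator_of_mem hφ, if_pos ((hT φ).1 hφ), relaxedSOS, PMF.normalize_apply]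
    · rw [Set.indicator_of_notMem hφ, if_neg fun h => hφ ((hT φ).2 h), zero_mul]
  have h2 : mass β T ≤ ENNReal.ofReal c * Z := by
    rw [hZ, ← mass_univ_eq hβ, ← ENNReal.ofReal_toReal (mass_ne_top hβ T),
      ← ENNReal.ofReal_toReal (mass_ne_top hβ Set.univ), ← ENNReal.ofReal_mul hc]
    exact ENNReal.ofReal_le_ofReal h
  rw [h1]
  calc mass β T * Z⁻¹ ≤ ENNReal.ofReal c * Z * Z⁻¹ := mul_le_mul_left h2 _
    _ = ENNReal.ofReal c := by rw [mul_assoc, ENNReal.mul_inv_cancel hZ0 hZt, mul_one]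

lemma hStar_nonneg {β : ℝ} (hβ : 0 < β) {n : ℕ} (hn : 1 ≤ n) : 0 ≤ hStar n β := by
  refine Int.floor_nonneg.2 ?_
  have : 0 ≤ Real.log n := Real.log_nonneg (by exact_mod_cast hn)
  positivity

/-- The shift `1/3` is tuned for this: the floor loses less than 1, and `6β(1/3 - 1) = -4β` is
compensated by the four edges around the first site. -/
lemma exp_hStar_le {β : ℝ} (hβ : 0 < β) {n : ℕ} (hn : 1 ≤ n) :
    Real.exp (-4 * β - 6 * β * (hStar n β : ℝ)) ≤ 1 / n := by
  have hn0 : (0 : ℝ) < n := by exact_mod_cast hn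
  have h1 := Int.sub_one_lt_floor (1 / (6 * β) * Real.log n + 1 / 3)
  change _ < ((hStar n β : ℤ) : ℝ) at h1
  have h2 : 6 * β * (1 / (6 * β) * Real.log n + 1 / 3 - 1) ≤ 6 * β * (hStar n β : ℝ) :=
    mul_le_mul_of_nonneg_left h1.le (by positivity)
  have h3 : 6 * β * (1 / (6 * β) * Real.log n + 1 / 3 - 1) = Real.log n - 4 * β := by
    field_simp
    ring
  rw [one_div, ← Real.exp_log (inv_pos.2 hn0), Real.exp_le_exp, Real.log_inv]
  linarith

end

end SOS

theorem mainTheorem2 :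
    ∃ C : ℝ, 0 < C ∧ ∃ β₀ : ℝ, ∀ (β : ℝ) (hβ : 0 < β), β₀ ≤ β →
      ∃ n₀ : ℕ, ∀ n : ℕ, n₀ ≤ n →
        (SOS.relaxedSOS n β hβ (SOS.lamW β)).toMeasure
            {φ : SOS.Config n |
              C * Real.exp (-β) * (n : ℝ) ^ 2 ≤
                ((Finset.univ.filter fun x : SOS.box n => SOS.hStar n β + 1 ≤ φ x).card : ℝ)}
          ≤ ENNReal.ofReal (Real.exp (-(n : ℝ) ^ (3 / 4 : ℝ))) := by
  -- The second bound on `n` gives `n^(1/4) ≥ 2 exp β`, hence `n^(3/4) ≤ exp(-β) n / 2`.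
  refine ⟨1, one_pos, 2 ^ 40, fun β hβ hβ₀ =>
    ⟨max (2 ^ 36) ⌈(2 * Real.exp β) ^ 4⌉₊, fun n hn => ?_⟩⟩
  have hn1 : 2 ^ 36 ≤ n := (le_max_left _ _).trans hn
  have hn1' : 1 ≤ n := le_trans (by norm_num) hn1
  have hn2 : (2 * Real.exp β) ^ 4 ≤ n :=
    (Nat.le_ceil _).trans (by exact_mod_cast (le_max_right _ _).trans hn)
  have hn0 : (0 : ℝ) < n := by exact_mod_cast hn1'
  obtain ⟨h, hh⟩ := Int.eq_ofNat_of_zero_le (SOS.hStar_nonneg hβ hn1')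
  have hexp := SOS.exp_hStar_le hβ hn1'
  rw [hh] at hexp ⊢
  rw [Int.cast_natCast] at hexp
  have hroot : 2 * Real.exp β ≤ (n : ℝ) ^ (1 / 4 : ℝ) := by
    have := Real.rpow_le_rpow (by positivity) hn2 (by norm_num : (0 : ℝ) ≤ 1 / 4)
    rwa [← Real.rpow_natCast, ← Real.rpow_mul (by positivity),
      show ((4 : ℕ) : ℝ) * (1 / 4) = 1 by norm_num, Real.rpow_one] at this
  have hpow : (n : ℝ) ^ (3 / 4 : ℝ) ≤ Real.exp (-β) / 2 * n := by
    have h1 : (n : ℝ) = (n : ℝ) ^ (3 / 4 : ℝ) * (n : ℝ) ^ (1 / 4 : ℝ) := by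
      rw [← Real.rpow_add hn0]
      norm_num
    have h2 : Real.exp (-β) / 2 * (2 * Real.exp β) = 1 := by
      rw [Real.exp_neg]
      field_simp
    calc (n : ℝ) ^ (3 / 4 : ℝ)
        = (n : ℝ) ^ (3 / 4 : ℝ) * (Real.exp (-β) / 2 * (2 * Real.exp β)) := by rw [h2, mul_one]
      _ ≤ (n : ℝ) ^ (3 / 4 : ℝ) * (Real.exp (-β) / 2 * (n : ℝ) ^ (1 / 4 : ℝ)) := by gcongr
      _ = Real.exp (-β) / 2 * ((n : ℝ) ^ (3 / 4 : ℝ) * (n : ℝ) ^ (1 / 4 : ℝ)) := by ring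
      _ = Real.exp (-β) / 2 * n := by rw [← h1]
  refine (SOS.toMeasure_le hβ ?_ (Real.exp_pos _).le (by
    simpa only [one_mul] using SOS.rmass_many_high_le hβ₀ hn1 hexp)).trans
    (ENNReal.ofReal_le_ofReal (Real.exp_le_exp.2 (neg_le_neg hpow)))
  -- The threshold `h + 1` is at least 1, so taking positive parts does not change the event.
  intro φ
  have hiff : ∀ x, ((h : ℤ) + 1 ≤ SOS.posPart φ x ↔ (h : ℤ) + 1 ≤ φ x) := fun x => by
    unfold SOS.posPart
    omega
  simp only [Set.mem_ofPred_eq, hiff]
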